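/- Let $F$ be a real closed field and let $k = F(i)$, $i^2 = -1$, be an algebraically closed field of characteristic $0$. Write $|z| = \sqrt{x^2+y^2} \in F$ for $z = x + iy \in k$ with $x, y \in F$. Let the torus $\mathbb{G}_m^r$ over $k$ act linearly on $\mathbb{P}^q$ so that the homogeneous coordinates $y_0, \dots, y_q$ have weights $a_0, \dots, a_q \in \mathbb{Z}^r$ (that is, $t \cdot [z_0 : \dots : z_q] = [t^{-a_0} z_0 : \dots : t^{-a_q} z_q]$), and let $$\mu : \mathbb{P}^q(k) \to F^r, \qquad \mu([z_0 : \dots : z_q]) = \frac{1}{\sum_j |z_j|^2} \sum_{j=0}^q |z_j|^2 a_j$$ be the moment map. Let $W \subset \mathbb{P}^q$ be a possibly non-normal projective toric variety, i.e., the Zariski closure of a $\mathbb{G}_m^r$-orbit (identified with its set of $k$-points). Let $R = \bigoplus_{n, u} R_{n,u}$ be the homogeneous coordinate ring of $W$, graded by degree $n \in \mathbb{N}$ and torus weight $u \in \mathbb{Z}^r$ (the class of $y_j$ lies in $R_{1,a_j}$), and let $S = \{(n,u) \in \mathbb{N} \times \mathbb{Z}^r \mid R_{n,u} \neq 0\}$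 be the semigroup of $W$. Put $$\Delta_{\mathbb{Q}}(S) = \{ u/n \mid (n,u) \in S,\ n > 0 \} \subset \mathbb{Q}^r,$$ let $\Delta(S) \subset F^r$ be the set of all $v \in F^r$ such that $(1,v)$ lies in the closure, for the order topology of $F$, of the convex cone generated by $S$ in $F \times F^r$, and let $\Delta_W(\mathcal{O}(1)) \subset F^r$ be the weight polytope of $W$, i.e., the convex hull of those $a_j$ for which $y_j$ does not vanish identically on $W$ (the convex hull of $a_0, \dots, a_q$ if $W$ lies in no coordinate hyperplane). Then $$\mu(W) \cap \mathbb{Q}^r = \Delta_{\mathbb{Q}}(S).$$ Moreover, $\mu(W)$ is convex and $$\mu(W) = \Delta_W(\mathcal{O}(1)) = \Delta(S).$$ -/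

import Mathlib

open scoped LinearAlgebra.Projectivization

namespace ToricMoment

noncomputable section

/-! ### The absolute value on `k = F(i)` -/

section Modulus

variable (F : Type*) {k : Type*} [Field F] [Field k] [Algebra F k]

/-- The coordinates `(x, y)` of `z = x + i y` with respect to the `F`-basis `1, i` of `k = F(i)`. -/
def reIm (i z : k) : F × F :=
  Classical.epsilon fun p : F × F => z = algebraMap F k p.1 + algebraMap F k p.2 * i

/-- The Euclidean norm `|z| = √(x ^ 2 + y ^ 2) ∈ F` of `z = x + i y`: the nonnegative square root
in the real closed field `F`. -/
def modulus [LinearOrder F] (i z : k) : F :=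
  Classical.epsilon fun r : F => 0 ≤ r ∧ r ^ 2 = (reIm F i z).1 ^ 2 + (reIm F i z).2 ^ 2

variable {F}

theorem reIm_spec {i : k} (hi : i ^ 2 = -1) (hk : IntermediateField.adjoin F {i} = ⊤) (z : k) :
    z = algebraMap F k (reIm F i z).1 + algebraMap F k (reIm F i z).2 * i := by
  refine Classical.epsilon_spec
    (p := fun p : F × F => z = algebraMap F k p.1 + algebraMap F k p.2 * i) ?_
  have hint : IsIntegral F i :=
    ⟨Polynomial.X ^ 2 + 1, by monicity!, by simp [hi]⟩
  have hz : z ∈ Algebra.adjoin F {i} := by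
    rw [← IntermediateField.adjoin_simple_toSubalgebra_of_isAlgebraic hint.isAlgebraic, hk]
    exact IntermediateField.mem_top
  induction hz using Algebra.adjoin_induction with
  | mem x hx => exact ⟨(0, 1), by simpa using hx⟩
  | algebraMap r => exact ⟨(r, 0), by simp⟩
  | add x y _ _ hx hy =>
    obtain ⟨p, rfl⟩ := hx
    obtain ⟨q, rfl⟩ := hy
    exact ⟨p + q, by simp only [Prod.fst_add, Prod.snd_add, map_add]; ring⟩
  | mul x y _ _ hx hy =>
    obtain ⟨p, rfl⟩ := hx
    obtain ⟨q, rfl⟩ := hy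
    refine ⟨(p.1 * q.1 - p.2 * q.2, p.1 * q.2 + p.2 * q.1), ?_⟩
    simp only [map_add, map_sub, map_mul]
    linear_combination (algebraMap F k p.2 * algebraMap F k q.2) * hi

variable [LinearOrder F] [IsStrictOrderedRing F]

theorem reIm_unique {i : k} (hi : i ^ 2 = -1) {x y x' y' : F}
    (h : algebraMap F k x + algebraMap F k y * i = algebraMap F k x' + algebraMap F k y' * i) :
    x = x' ∧ y = y' := by
  have hinj := (algebraMap F k).injective
  have h1 : (x - x') ^ 2 + (y - y') ^ 2 = 0 := by
    apply hinj
    simp only [map_add, map_sub, map_pow, map_zero]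
    linear_combination ((algebraMap F k x - algebraMap F k x') -
      (algebraMap F k y - algebraMap F k y') * i) * h +
      (algebraMap F k y - algebraMap F k y') ^ 2 * hi
  constructor <;> nlinarith [sq_nonneg (x - x'), sq_nonneg (y - y')]

theorem reIm_add_mul {i : k} (hi : i ^ 2 = -1) (hk : IntermediateField.adjoin F {i} = ⊤)
    (x y : F) : reIm F i (algebraMap F k x + algebraMap F k y * i) = (x, y) := by
  have h := reIm_unique hi (reIm_spec hi hk (algebraMap F k x + algebraMap F k y * i))
  exact Prod.ext h.1.symm h.2.symm

theorem modulus_spec [IsRealClosed F] (i z : k) :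
    0 ≤ modulus F i z ∧ modulus F i z ^ 2 = (reIm F i z).1 ^ 2 + (reIm F i z).2 ^ 2 := by
  refine Classical.epsilon_spec
    (p := fun r : F => 0 ≤ r ∧ r ^ 2 = (reIm F i z).1 ^ 2 + (reIm F i z).2 ^ 2) ?_
  obtain ⟨r, hr⟩ := IsRealClosed.exists_eq_pow_of_nonneg
    (x := (reIm F i z).1 ^ 2 + (reIm F i z).2 ^ 2) (by positivity) two_ne_zero
  exact ⟨|r|, abs_nonneg r, by rw [sq_abs, hr]⟩

theorem modulus_sq_mul [IsRealClosed F] {i : k} (hi : i ^ 2 = -1)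
    (hk : IntermediateField.adjoin F {i} = ⊤) (z w : k) :
    modulus F i (z * w) ^ 2 = modulus F i z ^ 2 * modulus F i w ^ 2 := by
  rw [(modulus_spec i _).2, (modulus_spec i z).2, (modulus_spec i w).2]
  have h : z * w = algebraMap F k ((reIm F i z).1 * (reIm F i w).1 -
      (reIm F i z).2 * (reIm F i w).2) + algebraMap F k ((reIm F i z).1 * (reIm F i w).2 +
      (reIm F i z).2 * (reIm F i w).1) * i := by
    conv_lhs => rw [reIm_spec hi hk z, reIm_spec hi hk w]
    simp only [map_add, map_sub, map_mul]
    linear_combination (algebraMap F k (reIm F i z).2 * algebraMap F k (reIm F i w).2) * hi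
  rw [h, reIm_add_mul hi hk]
  ring

theorem modulus_sq_pos [IsRealClosed F] {i : k} (hi : i ^ 2 = -1)
    (hk : IntermediateField.adjoin F {i} = ⊤) {z : k} (hz : z ≠ 0) :
    0 < modulus F i z ^ 2 := by
  refine lt_of_le_of_ne (sq_nonneg _) fun h => hz ?_
  rw [(modulus_spec i z).2] at h
  have h1 : (reIm F i z).1 = 0 := by
    nlinarith [sq_nonneg (reIm F i z).1, sq_nonneg (reIm F i z).2]
  have h2 : (reIm F i z).2 = 0 := by
    nlinarith [sq_nonneg (reIm F i z).1, sq_nonneg (reIm F i z).2]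
  rw [reIm_spec hi hk z, h1, h2]
  simp

end Modulus

/-! ### Projective toric varieties

Closed points of `ℙ^q` over `k` are elements of `ℙ k (Fin (q + 1) → k)`. -/

section Toric

variable {k : Type*} [Field k] {q r : ℕ}

/-- The character `t ↦ t ^ u` of the torus `𝔾ₘ^r`. -/
def character (u : Fin r → ℤ) (t : Fin r → kˣ) : kˣ := ∏ l, t l ^ u l

/-- The linear action of `t ∈ 𝔾ₘ^r` on `k ^ (q + 1)` for which the coordinate functions
`y_j` have weights `a_j`; since `(t · f)(v) = f (t⁻¹ · v)`, the vector `v` is sent to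
`(t ^ (-a_j) v_j)_j`. -/
def torusAct (a : Fin (q + 1) → Fin r → ℤ) (t : Fin r → kˣ) :
    (Fin (q + 1) → k) →ₗ[k] (Fin (q + 1) → k) where
  toFun v j := (character (-a j) t : k) * v j
  map_add' v w := by ext j; simp [mul_add]
  map_smul' c v := by ext j; simp [mul_left_comm]

theorem torusAct_injective (a : Fin (q + 1) → Fin r → ℤ) (t : Fin r → kˣ) :
    Function.Injective (torusAct a t) := by
  intro v w h
  ext j
  exact (character (-a j) t).isUnit.mul_left_cancel (congrFun h j)

/-- The orbit of `x` under the torus acting on `ℙ^q`. -/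
def orbit (a : Fin (q + 1) → Fin r → ℤ) (x : ℙ k (Fin (q + 1) → k)) :
    Set (ℙ k (Fin (q + 1) → k)) :=
  Set.range fun t : Fin r → kˣ => Projectivization.map (torusAct a t) (torusAct_injective a t) x

/-- The Zariski closure of a subset of `ℙ^q`: the common zero locus of all homogeneous polynomials
vanishing on it. -/
def zariskiClosure (A : Set (ℙ k (Fin (q + 1) → k))) : Set (ℙ k (Fin (q + 1) → k)) :=
  {p | ∀ (n : ℕ) (f : MvPolynomial (Fin (q + 1)) k), f.IsHomogeneous n →
    (∀ x ∈ A, MvPolynomial.eval x.rep f = 0) → MvPolynomial.eval p.rep f = 0}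

/-- `W ⊆ ℙ^q` is a (not necessarily normal) toric variety for the linear action of `𝔾ₘ^r` with
weights `a`: the Zariski closure of a torus orbit. -/
def IsToricVariety (a : Fin (q + 1) → Fin r → ℤ) (W : Set (ℙ k (Fin (q + 1) → k))) : Prop :=
  ∃ x, W = zariskiClosure (orbit a x)

/-- The homogeneous ideal of `W`. -/
def homogeneousIdeal (W : Set (ℙ k (Fin (q + 1) → k))) : Ideal (MvPolynomial (Fin (q + 1)) k) :=
  Ideal.span {f | (∃ n : ℕ, f.IsHomogeneous n) ∧ ∀ p ∈ W, MvPolynomial.eval p.rep f = 0}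

/-- The homogeneous coordinate ring of `W`. -/
abbrev CoordinateRing (W : Set (ℙ k (Fin (q + 1) → k))) : Type _ :=
  MvPolynomial (Fin (q + 1)) k ⧸ homogeneousIdeal W

/-- The part `R_{n,u}` of degree `n` and torus weight `u` of the homogeneous coordinate ring `R`
of `W`, each coordinate `y_j` having degree `1` and weight `a_j`. -/
def weightPiece (a : Fin (q + 1) → Fin r → ℤ) (W : Set (ℙ k (Fin (q + 1) → k)))
    (n : ℕ) (u : Fin r → ℤ) : Submodule k (CoordinateRing W) :=
  (MvPolynomial.homogeneousSubmodule (Fin (q + 1)) k n ⊓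
    MvPolynomial.weightedHomogeneousSubmodule k a u).map
      (Ideal.Quotient.mkₐ k (homogeneousIdeal W)).toLinearMap

/-- The semigroup `S ⊆ ℕ × ℤ^r` of `W`: the degrees and weights that occur in the homogeneous
coordinate ring of `W`. -/
def semigroup (a : Fin (q + 1) → Fin r → ℤ) (W : Set (ℙ k (Fin (q + 1) → k))) :
    Set (ℕ × (Fin r → ℤ)) :=
  {s | weightPiece a W s.1 s.2 ≠ ⊥}

end Toric

/-! ### Polytopes -/

section Polytope

variable {q r : ℕ}

/-- `Δ_ℚ(S) = {a / n | (n, a) ∈ S, n > 0} ⊆ ℚ^r`. -/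
def rationalBody (S : Set (ℕ × (Fin r → ℤ))) : Set (Fin r → ℚ) :=
  {w | ∃ s ∈ S, 0 < s.1 ∧ w = fun l => (s.2 l : ℚ) / (s.1 : ℚ)}

/-- The inclusion `ℚ^r ⊆ F^r`. -/
def ratVec (F : Type*) [Field F] (w : Fin r → ℚ) : Fin r → F := fun l => (w l : F)

/-- The Newton–Okounkov body `Δ(S)`: the slice at height `1` of the closure (in the Euclidean
topology) of the convex cone generated by `S` in `F × F^r`. -/
def newtonOkounkovBody (F : Type*) [Field F] [LinearOrder F] [IsStrictOrderedRing F]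
    [TopologicalSpace F] (S : Set (ℕ × (Fin r → ℤ))) : Set (Fin r → F) :=
  {v | ((1 : F), v) ∈ closure (PointedCone.hull F
    ((fun s : ℕ × (Fin r → ℤ) => ((s.1 : F), fun l => (s.2 l : F))) '' S) : Set (F × (Fin r → F)))}

/-- The weight polytope `Δ_W(𝒪(1))`: the convex hull in `F^r` of the weights `a_j` of the
homogeneous coordinates of `W` (coordinates that vanish identically on `W` are disregarded). -/
def weightPolytope (F : Type*) [Field F] [LinearOrder F] [IsStrictOrderedRing F]
    {k : Type*} [Field k] (a : Fin (q + 1) → Fin r → ℤ) (W : Set (ℙ k (Fin (q + 1) → k))) :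
    Set (Fin r → F) :=
  convexHull F ((fun j l => (a j l : F)) '' {j | ∃ p ∈ W, p.rep j ≠ 0})

/-- If `W` lies in no coordinate hyperplane, all the weights `a_0, …, a_q` are used. -/
theorem weightPolytope_eq (F : Type*) [Field F] [LinearOrder F] [IsStrictOrderedRing F]
    {k : Type*} [Field k] (a : Fin (q + 1) → Fin r → ℤ) (W : Set (ℙ k (Fin (q + 1) → k)))
    (hW : ∀ j, ∃ p ∈ W, p.rep j ≠ 0) :
    weightPolytope F a W = convexHull F (Set.range fun j l => (a j l : F)) := by
  have h : {j | ∃ p ∈ W, p.rep j ≠ 0} = Set.univ := Set.eq_univ_of_forall hW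
  rw [weightPolytope, h, Set.image_univ]

end Polytope

/-! ### The moment map -/

section MomentMap

variable (F : Type*) {k : Type*} [Field F] [LinearOrder F] [Field k] [Algebra F k] {q r : ℕ}

/-- The expression `|z|⁻² ∑ j, |z_j|² a_j` in `F^r`, where `|z|² = ∑ j, |z_j|²`. -/
def momentVec (i : k) (a : Fin (q + 1) → Fin r → ℤ) (z : Fin (q + 1) → k) : Fin r → F :=
  (∑ j, modulus F i (z j) ^ 2)⁻¹ • ∑ j, modulus F i (z j) ^ 2 • fun l => (a j l : F)

/-- The moment map `μ : ℙ^q → F^r`. -/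
def momentMap (i : k) (a : Fin (q + 1) → Fin r → ℤ) (p : ℙ k (Fin (q + 1) → k)) : Fin r → F :=
  momentVec F i a p.rep

variable {F}

/-- The moment map may be computed with any representative. -/
theorem momentMap_mk [IsStrictOrderedRing F] [IsRealClosed F] {i : k} (hi : i ^ 2 = -1)
    (hk : IntermediateField.adjoin F {i} = ⊤) (a : Fin (q + 1) → Fin r → ℤ)
    (z : Fin (q + 1) → k) (hz : z ≠ 0) :
    momentMap F i a (Projectivization.mk k z hz) = momentVec F i a z := by
  obtain ⟨c, hc⟩ := Projectivization.exists_smul_eq_mk_rep k z hz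
  have h (j) : modulus F i ((Projectivization.mk k z hz).rep j) ^ 2 =
      modulus F i (c : k) ^ 2 * modulus F i (z j) ^ 2 := by
    rw [← hc, ← modulus_sq_mul hi hk]
    simp [Units.smul_def]
  have hc0 : modulus F i (c : k) ^ 2 ≠ 0 := (modulus_sq_pos hi hk c.ne_zero).ne'
  simp only [momentMap, momentVec, h, mul_smul, ← Finset.smul_sum, ← Finset.mul_sum, mul_inv_rev,
    inv_smul_smul₀ hc0]

end MomentMap

end

end ToricMoment

set_option linter.unusedSectionVars false

namespace ToricMoment

open Polynomial

/-- The intermediate value property for polynomials over an ordered field. -/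
def PolynomialIVT (F : Type*) [Field F] [LinearOrder F] : Prop :=
  ∀ (p : F[X]) (a b : F), a < b → p.eval a * p.eval b < 0 → ∃ c ∈ Set.Ioo a b, p.eval c = 0

theorem polynomialIVT_real : PolynomialIVT ℝ := by
  intro p a b hab h
  have hc : ContinuousOn (fun x => p.eval x) (Set.Icc a b) := p.continuous.continuousOn
  rcases mul_neg_iff.1 h with ⟨ha, hb⟩ | ⟨ha, hb⟩
  · exact intermediate_value_Ioo' hab.le hc ⟨hb, ha⟩
  · exact intermediate_value_Ioo hab.le hc ⟨ha, hb⟩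

section RealClosed

variable {F k : Type*} [Field F] [LinearOrder F] [IsStrictOrderedRing F] [Field k] [IsAlgClosed k]
  [Algebra F k]

theorem exists_root_or_quadratic_dvd {i : k} (hi : i ^ 2 = -1)
    (hk : IntermediateField.adjoin F {i} = ⊤) (p : F[X]) (hp : p.natDegree ≠ 0) :
    (∃ x, p.eval x = 0) ∨ ∃ x y : F, y ≠ 0 ∧ (X ^ 2 - C (2 * x) * X + C (x ^ 2 + y ^ 2)) ∣ p := by
  obtain ⟨z, hz⟩ := IsAlgClosed.exists_aeval_eq_zero k p (by
    intro h; exact hp (natDegree_eq_zero_iff_degree_le_zero.2 h.le))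
  set x := (reIm F i z).1
  set y := (reIm F i z).2
  have hzxy : z = algebraMap F k x + algebraMap F k y * i := reIm_spec hi hk z
  by_cases hy : y = 0
  · left
    refine ⟨x, (algebraMap F k).injective ?_⟩
    rw [hzxy, hy] at hz
    simpa [aeval_algebraMap_apply] using hz
  · right
    refine ⟨x, y, hy, ?_⟩
    set Q : F[X] := X ^ 2 - C (2 * x) * X + C (x ^ 2 + y ^ 2) with hQ
    have hQdeg : Q.natDegree = 2 := by rw [hQ]; compute_degree!
    have hQm : Q.Monic := by rw [hQ]; monicity!
    have hQz : aeval z Q = 0 := by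
      rw [hQ, hzxy]
      simp only [map_add, map_sub, map_mul, map_pow, aeval_X, aeval_C, map_ofNat]
      linear_combination (algebraMap F k y) ^ 2 * hi
    rw [← modByMonic_eq_zero_iff_dvd hQm]
    set R := p %ₘ Q with hR
    have hRz : aeval z R = 0 := by
      have := congrArg (aeval z) (modByMonic_add_div p Q)
      simpa [hQz, hz] using this
    have hRdeg : R.natDegree ≤ 1 := by
      have := natDegree_modByMonic_lt p hQm (by intro h; simp [h] at hQdeg)
      rw [← hR, hQdeg] at this
      omega
    obtain ⟨m, n, hmn⟩ := exists_eq_X_add_C_of_natDegree_le_one hRdeg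
    rw [hmn, hzxy] at hRz
    simp only [map_add, map_mul, aeval_X, aeval_C] at hRz
    have h := reIm_unique (F := F) hi (x := m * x + n) (y := m * y) (x' := 0) (y' := 0) (by
      simp only [map_add, map_mul, map_zero]; linear_combination hRz)
    have hm : m = 0 := by simpa [hy] using h.2
    have hn : n = 0 := by simpa [hm] using h.1
    rw [hmn, hm, hn]; simp

theorem polynomialIVT_of_isAlgClosed {i : k} (hi : i ^ 2 = -1)
    (hk : IntermediateField.adjoin F {i} = ⊤) : PolynomialIVT F := by
  suffices H : ∀ n (p : F[X]) (a b : F), p.natDegree = n → a < b →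
      p.eval a * p.eval b < 0 → ∃ c ∈ Set.Ioo a b, p.eval c = 0 from
    fun p a b => H _ p a b rfl
  intro n
  induction n using Nat.strong_induction_on with
  | _ n ih =>
    intro p a b hpn hab h
    have hp0 : p ≠ 0 := by rintro rfl; simp at h
    by_cases hdeg : p.natDegree = 0
    · obtain ⟨c, rfl⟩ := natDegree_eq_zero.1 hdeg
      simp only [eval_C] at h
      nlinarith [mul_self_nonneg c]
    rcases exists_root_or_quadratic_dvd hi hk p hdeg with ⟨x, hx⟩ | ⟨x, y, hy, Q, hQ⟩
    · obtain ⟨Q, rfl⟩ := dvd_iff_isRoot.2 hx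
      have hQ0 : Q ≠ 0 := right_ne_zero_of_mul hp0
      have hd : Q.natDegree < n := by
        rw [natDegree_mul (X_sub_C_ne_zero x) hQ0, natDegree_X_sub_C] at hpn; omega
      by_cases hxm : x ∈ Set.Ioo a b
      · exact ⟨x, hxm, hx⟩
      simp only [eval_mul, eval_sub, eval_X, eval_C] at h ⊢
      have hpos : 0 ≤ (a - x) * (b - x) := by
        rcases le_or_gt x a with hxa | hxa
        · exact mul_nonneg (by linarith) (by linarith)
        · have : b ≤ x := by
            by_contra hbx; exact hxm ⟨hxa, not_le.1 hbx⟩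
          exact mul_nonneg_of_nonpos_of_nonpos (by linarith) (by linarith)
      obtain ⟨c, hc, hc0⟩ := ih _ hd Q a b rfl hab (by
        by_contra hneg
        nlinarith [mul_nonneg hpos (not_lt.1 hneg)])
      exact ⟨c, hc, by rw [hc0, mul_zero]⟩
    · have hQ0 : Q ≠ 0 := by rintro rfl; simp [hQ] at hp0
      have hpos : ∀ t, 0 < eval t (X ^ 2 - C (2 * x) * X + C (x ^ 2 + y ^ 2)) := by
        intro t
        have : eval t (X ^ 2 - C (2 * x) * X + C (x ^ 2 + y ^ 2)) = (t - x) ^ 2 + y ^ 2 := by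
          simp only [eval_add, eval_sub, eval_mul, eval_pow, eval_X, eval_C]; ring
        rw [this]; positivity
      have hd : Q.natDegree < n := by
        have h2 : (X ^ 2 - C (2 * x) * X + C (x ^ 2 + y ^ 2)).natDegree = 2 := by compute_degree!
        rw [hQ, natDegree_mul (by intro h0; rw [h0] at h2; simp at h2) hQ0, h2] at hpn; omega
      rw [hQ, eval_mul, eval_mul] at h
      obtain ⟨c, hc, hc0⟩ := ih _ hd Q a b rfl hab (by
        by_contra hneg
        nlinarith [mul_nonneg (mul_pos (hpos a) (hpos b)).le (not_lt.1 hneg)])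
      exact ⟨c, hc, by rw [hQ, eval_mul, hc0, mul_zero]⟩

end RealClosed

section OrderedField

variable {F : Type*} [Field F] [LinearOrder F] [IsStrictOrderedRing F]

theorem PolynomialIVT.sign_eq (hF : PolynomialIVT F) {p : F[X]} {a b : F} (hab : a ≤ b)
    (h : ∀ c ∈ Set.Icc a b, p.eval c ≠ 0) :
    SignType.sign (p.eval a) = SignType.sign (p.eval b) := by
  rcases hab.eq_or_lt with rfl | hab
  · rfl
  have ha := h a ⟨le_rfl, hab.le⟩
  have hb := h b ⟨hab.le, le_rfl⟩
  rcases ha.lt_or_gt with ha | ha <;> rcases hb.lt_or_gt with hb | hb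
  · rw [sign_neg ha, sign_neg hb]
  · obtain ⟨c, hc, h0⟩ := hF p a b hab (mul_neg_of_neg_of_pos ha hb)
    exact absurd h0 (h c ⟨hc.1.le, hc.2.le⟩)
  · obtain ⟨c, hc, h0⟩ := hF p a b hab (mul_neg_of_pos_of_neg ha hb)
    exact absurd h0 (h c ⟨hc.1.le, hc.2.le⟩)
  · rw [sign_pos ha, sign_pos hb]

/-- Rolle's theorem between two consecutive roots. -/
theorem PolynomialIVT.rolle_aux (hF : PolynomialIVT F) {p : F[X]} {a b : F} (hab : a < b)
    (hp : p ≠ 0) (ha : p.eval a = 0) (hb : p.eval b = 0)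
    (hroots : ∀ c ∈ Set.Ioo a b, p.eval c ≠ 0) : ∃ c ∈ Set.Ioo a b, p.derivative.eval c = 0 := by
  obtain ⟨p₁, hp₁, hdvd₁⟩ := exists_eq_pow_rootMultiplicity_mul_and_not_dvd p hp a
  have hm : 0 < p.rootMultiplicity a := (rootMultiplicity_pos hp).2 ha
  obtain ⟨m, hm'⟩ := Nat.exists_eq_succ_of_ne_zero hm.ne'
  rw [hm'] at hp₁
  have hp₁0 : p₁ ≠ 0 := by rintro rfl; simp at hdvd₁
  have hb₁ : p₁.eval b = 0 := by
    rw [hp₁, eval_mul, eval_pow, eval_sub, eval_X, eval_C] at hb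
    exact (mul_eq_zero.1 hb).resolve_left (pow_ne_zero _ (sub_ne_zero.2 hab.ne'))
  obtain ⟨g, hg, hdvd₂⟩ := exists_eq_pow_rootMultiplicity_mul_and_not_dvd p₁ hp₁0 b
  have hn : 0 < p₁.rootMultiplicity b := (rootMultiplicity_pos hp₁0).2 hb₁
  obtain ⟨n, hn'⟩ := Nat.exists_eq_succ_of_ne_zero hn.ne'
  rw [hn'] at hg
  have hga : g.eval a ≠ 0 := by
    intro h0
    refine hdvd₁ (dvd_iff_isRoot.2 ?_)
    rw [IsRoot, hg, eval_mul, h0, mul_zero]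
  have hgb : g.eval b ≠ 0 := fun h0 => hdvd₂ (dvd_iff_isRoot.2 h0)
  have hpg : p = (X - C a) ^ (m + 1) * ((X - C b) ^ (n + 1) * g) := by rw [hp₁, hg]
  have hsign : 0 < g.eval a * g.eval b := by
    by_contra hneg
    have hne : g.eval a * g.eval b ≠ 0 := mul_ne_zero hga hgb
    obtain ⟨c, hc, h0⟩ := hF g a b hab (lt_of_le_of_ne (not_lt.1 hneg) hne)
    exact hroots c hc (by rw [hpg, eval_mul, eval_mul, h0, mul_zero, mul_zero])
  set h : F[X] := C ((m + 1 : ℕ) : F) * (X - C b) * g + C ((n + 1 : ℕ) : F) * (X - C a) * g +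
    (X - C a) * (X - C b) * derivative g with hh
  have hder : derivative p = (X - C a) ^ m * (X - C b) ^ n * h := by
    rw [hpg, hh]
    simp only [derivative_mul, derivative_X_sub_C_pow, add_tsub_cancel_right]
    simp only [pow_succ, map_natCast]
    ring
  obtain ⟨c, hc, h0⟩ := hF h a b hab (by
    have h1 : h.eval a = ((m + 1 : ℕ) : F) * (a - b) * g.eval a := by simp [hh]
    have h2 : h.eval b = ((n + 1 : ℕ) : F) * (b - a) * g.eval b := by simp [hh]
    rw [h1, h2]
    have hmp : (0 : F) < ((m + 1 : ℕ) : F) := by positivity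
    have hnp : (0 : F) < ((n + 1 : ℕ) : F) := by positivity
    have hba := sub_pos.2 hab
    have : 0 < ((m + 1 : ℕ) : F) * (b - a) * (((n + 1 : ℕ) : F) * (b - a)) *
        (g.eval a * g.eval b) := by positivity
    linarith)
  exact ⟨c, hc, by rw [hder, eval_mul, h0, mul_zero]⟩

theorem PolynomialIVT.rolle (hF : PolynomialIVT F) {p : F[X]} {a b : F} (hab : a < b)
    (ha : p.eval a = 0) (hb : p.eval b = 0) : ∃ c ∈ Set.Ioo a b, p.derivative.eval c = 0 := by
  by_cases hp : p = 0
  · obtain ⟨c, hc⟩ := exists_between hab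
    exact ⟨c, hc, by simp [hp]⟩
  have hne : (p.roots.toFinset.filter (a < ·)).Nonempty :=
    ⟨b, by simp [hp, hb, hab]⟩
  obtain ⟨b', hb', hmin⟩ := Finset.exists_min_image _ id hne
  simp only [Finset.mem_filter, Multiset.mem_toFinset, mem_roots hp, IsRoot, id] at hb' hmin
  obtain ⟨c, hc, h0⟩ := hF.rolle_aux hb'.2 hp ha hb'.1 (fun c hc h0 =>
    absurd (hmin c ⟨h0, hc.1⟩) (not_le.2 hc.2))
  exact ⟨c, ⟨hc.1, hc.2.trans_le (hmin b ⟨hb, hab⟩)⟩, h0⟩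

theorem PolynomialIVT.mean_value (hF : PolynomialIVT F) (p : F[X]) {a b : F} (hab : a < b) :
    ∃ c ∈ Set.Ioo a b, p.eval b - p.eval a = (b - a) * p.derivative.eval c := by
  obtain ⟨c, hc, h0⟩ := hF.rolle
    (p := C (b - a) * (p - C (p.eval a)) - C (p.eval b - p.eval a) * (X - C a)) hab
    (by simp) (by simp; ring)
  refine ⟨c, hc, ?_⟩
  simp at h0
  linarith

theorem exists_le_leadingCoeff_mul_eval (p : F[X]) (hp : p ≠ 0) :
    ∃ δ > 0, ∃ M : F, ∀ x, M < x → δ ≤ p.leadingCoeff * p.eval x := by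
  suffices H : ∀ n (p : F[X]), p.natDegree = n → p ≠ 0 →
      ∃ δ > 0, ∃ M : F, ∀ x, M < x → δ ≤ p.leadingCoeff * p.eval x from H _ p rfl hp
  clear hp p
  intro n
  induction n with
  | zero =>
    intro p hd hp
    obtain ⟨c, rfl⟩ := natDegree_eq_zero.1 hd
    have hc : c ≠ 0 := by simpa using hp
    exact ⟨c * c, mul_self_pos.2 hc, 0, fun x _ => by simp⟩
  | succ n ih =>
    intro p hd hp
    have hdd : p.divX.natDegree = n := by rw [natDegree_divX_eq_natDegree_tsub_one, hd]; rfl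
    have hlc : p.divX.leadingCoeff = p.leadingCoeff := by
      rw [leadingCoeff, leadingCoeff, hdd, coeff_divX, hd]
    have hdX : p.divX ≠ 0 := by
      intro h0
      rw [h0, leadingCoeff_zero] at hlc
      exact hp (leadingCoeff_eq_zero.1 hlc.symm)
    obtain ⟨δ, hδ, M, hM⟩ := ih p.divX hdd hdX
    refine ⟨δ, hδ, max (max M 0) (1 + |p.leadingCoeff * p.coeff 0| / δ), fun x hx => ?_⟩
    have hx1 : M < x := lt_of_le_of_lt ((le_max_left _ _).trans (le_max_left _ _)) hx
    have hx2 : 0 < x := lt_of_le_of_lt ((le_max_right _ _).trans (le_max_left _ _)) hx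
    have hx3 : 1 + |p.leadingCoeff * p.coeff 0| / δ < x := lt_of_le_of_lt (le_max_right _ _) hx
    have h1 := mul_le_mul_of_nonneg_left (hM x hx1) hx2.le
    have h2 : p.eval x = x * p.divX.eval x + p.coeff 0 := by
      conv_lhs => rw [← X_mul_divX_add p]
      simp only [eval_add, eval_mul, eval_X, eval_C]
    have h3 : (1 + |p.leadingCoeff * p.coeff 0| / δ) * δ = δ + |p.leadingCoeff * p.coeff 0| := by
      field_simp
    have h4 := mul_lt_mul_of_pos_right hx3 hδ
    rw [h3] at h4
    have h5 := neg_abs_le (p.leadingCoeff * p.coeff 0)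
    rw [hlc] at h1
    rw [h2]
    nlinarith

theorem exists_eval_pos_of_derivative_pos (p : F[X]) (b : F)
    (h : ∀ x, b < x → 0 < p.derivative.eval x) : ∃ x, b < x ∧ 0 < p.eval x := by
  have hd0 : derivative p ≠ 0 := by
    intro h0
    have := h (b + 1) (by linarith)
    simp [h0] at this
  have hp0 : p ≠ 0 := by rintro rfl; simp at hd0
  obtain ⟨δ, hδ, M, hM⟩ := exists_le_leadingCoeff_mul_eval p hp0
  obtain ⟨δ', hδ', M', hM'⟩ := exists_le_leadingCoeff_mul_eval _ hd0
  set x := max b (max M M') + 1 with hx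
  have hxb : b < x := lt_of_le_of_lt (le_max_left _ _) (lt_add_one _)
  have hxM : M < x :=
    lt_of_le_of_lt ((le_max_left _ _).trans (le_max_right _ _)) (lt_add_one _)
  have hxM' : M' < x :=
    lt_of_le_of_lt ((le_max_right _ _).trans (le_max_right _ _)) (lt_add_one _)
  have hlc' : 0 < (derivative p).leadingCoeff :=
    pos_of_mul_pos_left (hδ'.trans_le (hM' x hxM')) (h x hxb).le
  have hnd : p.natDegree ≠ 0 := by
    intro h0; exact hd0 (derivative_of_natDegree_zero h0)
  have hlc : 0 < p.leadingCoeff := by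
    have h1 : (derivative p).leadingCoeff = p.leadingCoeff * p.natDegree := by
      rw [leadingCoeff, natDegree_derivative, coeff_derivative, leadingCoeff,
        Nat.sub_add_cancel (Nat.pos_of_ne_zero hnd)]
      congr 1
      exact_mod_cast congrArg (Nat.cast : ℕ → F) (Nat.sub_add_cancel (Nat.pos_of_ne_zero hnd))
    rw [h1] at hlc'
    exact pos_of_mul_pos_left hlc' (Nat.cast_nonneg _)
  exact ⟨x, hxb, pos_of_mul_pos_right (hδ.trans_le (hM x hxM)) hlc.le⟩

end OrderedField

end ToricMoment

namespace ToricMoment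

open Polynomial

section SignTables

variable {F K : Type*} [Field F] [LinearOrder F] [IsStrictOrderedRing F]
  [Field K] [LinearOrder K] [IsStrictOrderedRing K]

theorem sign_eq_sign_iff {a : F} {b : K} :
    SignType.sign a = SignType.sign b ↔ (0 < a ↔ 0 < b) ∧ (a < 0 ↔ b < 0) := by
  constructor
  · intro h
    rw [← sign_eq_one_iff, ← sign_eq_one_iff, ← sign_eq_neg_one_iff, ← sign_eq_neg_one_iff, h]
    simp
  · rintro ⟨h1, h2⟩
    rcases lt_trichotomy a 0 with h | h | h
    · rw [sign_neg h, sign_neg (h2.1 h)]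
    · have hb : b = 0 := le_antisymm (not_lt.1 fun hb => (h1.2 hb).ne' h)
        (not_lt.1 fun hb => (h2.2 hb).ne h)
      rw [h, hb, sign_zero, sign_zero]
    · rw [sign_pos h, sign_pos (h1.1 h)]

/-- `x` and `y` lie in corresponding cuts with respect to a set of pairs. -/
def SameCut (G : Set (F × K)) (x : F) (y : K) : Prop :=
  ∀ z ∈ G, (z.1 < x ↔ z.2 < y) ∧ (x < z.1 ↔ y < z.2)

theorem SameCut.mono {G G' : Set (F × K)} (h : G ⊆ G') {x : F} {y : K} (hxy : SameCut G' x y) :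
    SameCut G x y := fun z hz => hxy z (h hz)

theorem SameCut.eq_right {G : Set (F × K)} {x : F} {y y' : K} (h : SameCut G x y)
    (hy : (x, y') ∈ G) : y = y' := by
  have := h _ hy
  simp only [lt_self_iff_false, false_iff, not_lt] at this
  exact le_antisymm this.1 this.2

theorem SameCut.eq_left {G : Set (F × K)} {x x' : F} {y : K} (h : SameCut G x y)
    (hy : (x', y) ∈ G) : x = x' := by
  have := h _ hy
  simp only [lt_self_iff_false, iff_false, not_lt] at this
  exact le_antisymm this.1 this.2

theorem SameCut.swap {G : Set (F × K)} {x : F} {y : K} (h : SameCut G x y) :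
    SameCut (Prod.swap ⁻¹' G) y x := fun _ hz => ⟨(h _ hz).1.symm, (h _ hz).2.symm⟩

theorem SameCut.of_swap {G : Set (F × K)} {x : F} {y : K} (h : SameCut (Prod.swap ⁻¹' G) y x) :
    SameCut G x y := fun z hz => ⟨(h z.swap (by simpa using hz)).1.symm,
      (h z.swap (by simpa using hz)).2.symm⟩

theorem SameCut.exists {G : Set (F × K)} (hfin : G.Finite) (hG : ∀ z ∈ G, SameCut G z.1 z.2)
    (x : F) : ∃ y, SameCut G x y := by
  classical
  by_cases hx : ∃ y, (x, y) ∈ G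
  · obtain ⟨y, hy⟩ := hx
    exact ⟨y, hG _ hy⟩
  obtain ⟨y, hy1, hy2⟩ := Order.exists_between_finsets
    ((hfin.toFinset.filter (·.1 < x)).image Prod.snd)
    ((hfin.toFinset.filter (x < ·.1)).image Prod.snd) (by
      intro a ha b hb
      simp only [Finset.mem_image, Finset.mem_filter, Set.Finite.mem_toFinset] at ha hb
      obtain ⟨z, ⟨hz, hzx⟩, rfl⟩ := ha
      obtain ⟨w, ⟨hw, hwx⟩, rfl⟩ := hb
      exact (hG w hw z hz).1.1 (hzx.trans hwx))
  simp only [Finset.mem_image, Finset.mem_filter, Set.Finite.mem_toFinset, forall_exists_index,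
    and_imp] at hy1 hy2
  refine ⟨y, fun z hz => ?_⟩
  rcases lt_trichotomy z.1 x with h | h | h
  · have := hy1 _ z hz h rfl
    simp [h, this, h.not_gt, this.not_gt]
  · exact absurd ⟨z.2, h ▸ hz⟩ hx
  · have := hy2 _ z hz h rfl
    simp [h, this, h.not_gt, this.not_gt]

/-- Polynomials `f`, `g` over `F`, `K` whose derivatives have their roots among the pairs in `G`
and equal signs on corresponding cuts. -/
structure Matched (G : Set (F × K)) (f : F[X]) (g : K[X]) : Prop where
  finite : G.Finite
  cut : ∀ z ∈ G, SameCut G z.1 z.2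
  sign : ∀ z ∈ G, SignType.sign (f.eval z.1) = SignType.sign (g.eval z.2)
  der : ∀ x y, SameCut G x y →
    SignType.sign (f.derivative.eval x) = SignType.sign (g.derivative.eval y)
  root_left : ∀ x, f.derivative.eval x = 0 → ∃ y, (x, y) ∈ G
  root_right : ∀ y, g.derivative.eval y = 0 → ∃ x, (x, y) ∈ G

namespace Matched

variable {G : Set (F × K)} {f : F[X]} {g : K[X]}

theorem neg (M : Matched G f g) : Matched G (-f) (-g) where
  finite := M.finite
  cut := M.cut
  sign z hz := by
    have := M.sign z hz
    rw [sign_eq_sign_iff] at this ⊢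
    simpa [and_comm] using this
  der x y h := by
    have := M.der x y h
    rw [sign_eq_sign_iff] at this ⊢
    simpa [and_comm] using this
  root_left x hx := M.root_left x (by simpa using hx)
  root_right x hx := M.root_right x (by simpa using hx)

theorem swap (M : Matched G f g) : Matched (Prod.swap ⁻¹' G) g f where
  finite := M.finite.preimage Prod.swap_injective.injOn
  cut _ hz := (M.cut _ hz).swap
  sign _ hz := (M.sign _ hz).symm
  der x y h := (M.der y x h.of_swap).symm
  root_left x hx := M.root_right x hx
  root_right x hx := M.root_left x hx

theorem _root_.ToricMoment.sameCut_neg {x : F} {y : K} :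
    SameCut ((fun z : F × K => (-z.1, -z.2)) ⁻¹' G) x y ↔ SameCut G (-x) (-y) := by
  constructor
  · intro h z hz
    have := h (-z.1, -z.2) (by simpa using hz)
    exact ⟨lt_neg.trans (this.2.trans lt_neg), neg_lt.trans (this.1.trans neg_lt)⟩
  · intro h z hz
    have := h _ hz
    simp only [neg_lt_neg_iff] at this
    exact ⟨this.2, this.1⟩

theorem reflect (M : Matched G f g) :
    Matched ((fun z : F × K => (-z.1, -z.2)) ⁻¹' G) (f.comp (-X)) (g.comp (-X)) where
  finite := M.finite.preimage (fun z _ w _ h => by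
    simp only [Prod.mk.injEq, neg_inj] at h; exact Prod.ext h.1 h.2)
  cut z hz := sameCut_neg.2 (M.cut _ hz)
  sign z hz := by simpa using M.sign _ hz
  der x y h := by
    have := M.der _ _ (sameCut_neg.1 h)
    rw [sign_eq_sign_iff] at this ⊢
    simpa [derivative_comp, and_comm] using this
  root_left x hx := by
    obtain ⟨y, hy⟩ := M.root_left (-x) (by simpa [derivative_comp] using hx)
    exact ⟨-y, by simpa using hy⟩
  root_right y hy := by
    obtain ⟨x, hx⟩ := M.root_right (-y) (by simpa [derivative_comp] using hy)
    exact ⟨-x, by simpa using hx⟩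

theorem exists_root_right (hF : PolynomialIVT F) (hK : PolynomialIVT K) (M : Matched G f g)
    {x : F} {y : K} (h : SameCut G x y) (hx : 0 ≤ f.eval x) (hy : g.eval y < 0)
    (hd : 0 < f.derivative.eval x) : ∃ y₀, g.eval y₀ = 0 ∧ SameCut G x y₀ ∧ y < y₀ := by
  have hxG : ∀ y', (x, y') ∉ G := by
    intro y' hy'
    have h1 := h.eq_right hy'
    have h2 := (sign_eq_sign_iff.1 (M.sign _ hy')).2.2 (by simpa [← h1] using hy)
    exact absurd hx (not_le.2 h2)
  have hyG : ∀ x', (x', y) ∉ G := by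
    intro x' hx'
    exact hxG y (by rwa [h.eq_left hx'])
  have hd' : 0 < g.derivative.eval y := (sign_eq_sign_iff.1 (M.der x y h)).1.1 hd
  suffices H : ∃ b, y < b ∧ 0 < g.eval b ∧ ∀ z ∈ G, x < z.1 → b ≤ z.2 by
    obtain ⟨b, hyb, hb, hzb⟩ := H
    obtain ⟨y₀, hy₀, hy₀'⟩ := hK g y b hyb (mul_neg_of_neg_of_pos hy hb)
    refine ⟨y₀, hy₀', fun z hz => ?_, hy₀.1⟩
    rcases lt_trichotomy z.1 x with hzx | hzx | hzx
    · have := ((h z hz).1.1 hzx).trans hy₀.1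
      simp [hzx, this, hzx.not_gt, this.not_gt]
    · exact absurd (hzx ▸ hz : (x, z.2) ∈ G) (hxG _)
    · have := hy₀.2.trans_le (hzb z hz hzx)
      simp [hzx, this, hzx.not_gt, this.not_gt]
  by_cases hne : ∃ z ∈ G, x < z.1
  · obtain ⟨w, ⟨hw, hxw⟩, hmin⟩ := Set.exists_min_image {z ∈ G | x < z.1} Prod.fst
      (M.finite.subset (Set.sep_subset _ _)) hne
    have hpos : 0 < f.eval w.1 := by
      obtain ⟨c, hc, hcc⟩ := hF.mean_value f hxw
      have hsign : SignType.sign (f.derivative.eval x) = SignType.sign (f.derivative.eval c) := by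
        refine hF.sign_eq hc.1.le fun t ht h0 => ?_
        obtain ⟨y', hy'⟩ := M.root_left t h0
        rcases ht.1.eq_or_lt with rfl | hxt
        · exact hxG _ hy'
        · exact absurd (hmin _ ⟨hy', hxt⟩) (not_le.2 (ht.2.trans_lt hc.2))
      have hcpos : 0 < f.derivative.eval c := by
        rw [← sign_eq_one_iff, ← hsign, sign_pos hd]
      have := mul_pos (sub_pos.2 hxw) hcpos
      linarith
    refine ⟨w.2, (h w hw).2.1 hxw, (sign_eq_sign_iff.1 (M.sign w hw)).1.1 hpos, fun z hz hxz => ?_⟩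
    by_contra hlt
    exact absurd ((M.cut w hw z hz).1.2 (not_le.1 hlt)) (not_lt.2 (hmin z ⟨hz, hxz⟩))
  · push Not at hne
    obtain ⟨b, hb, hgb⟩ := exists_eval_pos_of_derivative_pos g y (fun t ht => by
      have hsign : SignType.sign (g.derivative.eval y) = SignType.sign (g.derivative.eval t) := by
        refine hK.sign_eq ht.le fun s hs h0 => ?_
        obtain ⟨x', hx'⟩ := M.root_right s h0
        rcases hs.1.eq_or_lt with rfl | hys
        · exact hyG _ hx'
        · exact absurd ((h _ hx').2.2 hys) (not_lt.2 (hne _ hx'))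
      rw [← sign_eq_one_iff, ← hsign, sign_pos hd'])
    exact ⟨b, hb, hgb, fun z hz hxz => absurd hxz (not_lt.2 (hne z hz))⟩

theorem exists_root (hF : PolynomialIVT F) (hK : PolynomialIVT K) (M : Matched G f g)
    {x : F} {y : K} (h : SameCut G x y) (hx : 0 ≤ f.eval x) (hy : g.eval y < 0) :
    ∃ y₀, g.eval y₀ = 0 ∧ SameCut G x y₀ ∧ (0 < f.derivative.eval x → y < y₀) ∧
      (f.derivative.eval x < 0 → y₀ < y) := by
  rcases lt_trichotomy (f.derivative.eval x) 0 with hd | hd | hd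
  · obtain ⟨y₀, h1, h2, h3⟩ := M.reflect.exists_root_right hF hK (x := -x) (y := -y)
      (sameCut_neg.2 (by simpa using h)) (by simpa using hx) (by simpa using hy)
      (by simpa [derivative_comp] using hd)
    have h2' := sameCut_neg.1 h2
    rw [neg_neg] at h2'
    exact ⟨-y₀, by simpa using h1, h2', fun h => absurd h hd.not_gt, fun _ => neg_lt.1 h3⟩
  · obtain ⟨y', hy'⟩ := M.root_left x hd
    have h1 := h.eq_right hy'
    have h2 := (sign_eq_sign_iff.1 (M.sign _ hy')).2.2 (by simpa [← h1] using hy)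
    exact absurd hx (not_le.2 h2)
  · obtain ⟨y₀, h1, h2, h3⟩ := M.exists_root_right hF hK h hx hy hd
    exact ⟨y₀, h1, h2, fun _ => h3, fun h => absurd h hd.not_gt⟩

/-- Every root of `f` has a root of `g` in the corresponding cut. -/
theorem exists_paired_root (hF : PolynomialIVT F) (hK : PolynomialIVT K) (M : Matched G f g)
    {x : F} (hx : f.eval x = 0) : ∃ y, g.eval y = 0 ∧ SameCut G x y := by
  obtain ⟨y, hy⟩ := SameCut.exists M.finite M.cut x
  rcases lt_trichotomy (g.eval y) 0 with h | h | h
  · obtain ⟨y₀, h1, h2, -⟩ := M.exists_root hF hK hy hx.ge h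
    exact ⟨y₀, h1, h2⟩
  · exact ⟨y, h, hy⟩
  · obtain ⟨y₀, h1, h2, -⟩ := M.neg.exists_root hF hK hy (by simp [hx]) (by simpa using h)
    exact ⟨y₀, by simpa using h1, h2⟩

/-- The pairs in `G` together with the pairs of corresponding roots of `f` and `g`. -/
def extend (G : Set (F × K)) (f : F[X]) (g : K[X]) : Set (F × K) :=
  G ∪ {z | f.eval z.1 = 0 ∧ g.eval z.2 = 0 ∧ SameCut G z.1 z.2}

theorem sameCut_of_mem_extend (M : Matched G f g) {z : F × K} (hz : z ∈ extend G f g) :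
    SameCut G z.1 z.2 := hz.elim (M.cut z) fun h => h.2.2

theorem extend_swap : extend (Prod.swap ⁻¹' G) g f = Prod.swap ⁻¹' extend G f g := by
  ext z
  simp only [extend, Set.mem_union, Set.mem_preimage, Set.mem_ofPred_eq, Prod.fst_swap,
    Prod.snd_swap]
  exact or_congr Iff.rfl ⟨fun h => ⟨h.2.1, h.1, h.2.2.of_swap⟩, fun h => ⟨h.2.1, h.1, h.2.2.swap⟩⟩

theorem lt_of_mem_extend (hF : PolynomialIVT F) (M : Matched G f g) {z w : F × K}
    (hz : z ∈ extend G f g) (hw : w ∈ extend G f g) (h : z.1 < w.1) : z.2 < w.2 := by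
  have hzc := M.sameCut_of_mem_extend hz
  have hwc := M.sameCut_of_mem_extend hw
  rcases hz with hz | hz
  · exact (hwc z hz).1.1 h
  rcases hw with hw | hw
  · exact (hzc w hw).2.1 h
  obtain ⟨c, hc, h0⟩ := hF.rolle h hz.1 hw.1
  obtain ⟨c', hc'⟩ := M.root_left c h0
  exact ((hzc _ hc').2.1 hc.1).trans ((hwc _ hc').1.1 hc.2)

theorem lt_iff_of_mem_extend (hF : PolynomialIVT F) (hK : PolynomialIVT K) (M : Matched G f g)
    {z w : F × K} (hz : z ∈ extend G f g) (hw : w ∈ extend G f g) : z.1 < w.1 ↔ z.2 < w.2 :=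
  ⟨M.lt_of_mem_extend hF hz hw, M.swap.lt_of_mem_extend (z := z.swap) (w := w.swap) hK
    (by rw [extend_swap]; simpa using hz) (by rw [extend_swap]; simpa using hw)⟩

theorem extend_cut (hF : PolynomialIVT F) (hK : PolynomialIVT K) (M : Matched G f g)
    {z : F × K} (hz : z ∈ extend G f g) : SameCut (extend G f g) z.1 z.2 :=
  fun _ hw => ⟨M.lt_iff_of_mem_extend hF hK hw hz, M.lt_iff_of_mem_extend hF hK hz hw⟩

theorem extend_finite (M : Matched G f g) (hf : f ≠ 0) (hg : g ≠ 0) : (extend G f g).Finite := by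
  classical
  refine M.finite.union (Set.Finite.subset
    (Set.Finite.prod f.roots.toFinset.finite_toSet g.roots.toFinset.finite_toSet) ?_)
  rintro z ⟨h1, h2, -⟩
  simp [hf, hg, h1, h2]

theorem not_pos_neg (hF : PolynomialIVT F) (hK : PolynomialIVT K) (M : Matched G f g)
    {x : F} {y : K} (h : SameCut (extend G f g) x y) (hx : 0 < f.eval x) (hy : g.eval y < 0) :
    False := by
  have hG : SameCut G x y := h.mono Set.subset_union_left
  obtain ⟨y₀, hy₀, hxy₀, h1, h2⟩ := M.exists_root hF hK hG hx.le hy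
  obtain ⟨x₀, hx₀, hyx₀, h3, h4⟩ := M.neg.swap.exists_root hK hF hG.swap
    (by simpa using hy.le) (by simpa using hx)
  have hyx₀ := hyx₀.of_swap
  simp only [eval_neg, neg_eq_zero, derivative_neg, Left.neg_pos_iff, Left.neg_neg_iff] at hx₀ h3 h4
  have hmem : (x₀, y₀) ∈ extend G f g := Or.inr ⟨hx₀, hy₀, fun z hz =>
    ⟨(hyx₀ z hz).1.trans ((hG z hz).1.symm.trans (hxy₀ z hz).1),
      (hyx₀ z hz).2.trans ((hG z hz).2.symm.trans (hxy₀ z hz).2)⟩⟩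
  have hder := sign_eq_sign_iff.1 (M.der x y hG)
  rcases lt_trichotomy (f.derivative.eval x) 0 with hd | hd | hd
  · have hx := h3 (hder.2.1 hd)
    exact absurd ((h _ hmem).2.1 hx) (h2 hd).not_gt
  · obtain ⟨y', hy'⟩ := M.root_left x hd
    have h1 := hG.eq_right hy'
    have h2 := (sign_eq_sign_iff.1 (M.sign _ hy')).2.2 (by simpa [← h1] using hy)
    exact absurd hx.le (not_le.2 h2)
  · have hx := h4 (hder.1.1 hd)
    exact absurd ((h _ hmem).1.1 hx) (h1 hd).not_gt

theorem eval_eq_zero (hF : PolynomialIVT F) (hK : PolynomialIVT K) (M : Matched G f g)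
    {x : F} {y : K} (h : SameCut (extend G f g) x y) (hx : f.eval x = 0) : g.eval y = 0 := by
  obtain ⟨y₀, hy₀, hc⟩ := M.exists_paired_root hF hK hx
  rwa [h.eq_right (Or.inr ⟨hx, hy₀, hc⟩)]

theorem extend_sign (hF : PolynomialIVT F) (hK : PolynomialIVT K) (M : Matched G f g)
    {x : F} {y : K} (h : SameCut (extend G f g) x y) :
    SignType.sign (f.eval x) = SignType.sign (g.eval y) := by
  have h' : SameCut (extend (Prod.swap ⁻¹' G) g f) y x := by rw [extend_swap]; exact h.swap
  rcases lt_trichotomy (f.eval x) 0 with hx | hx | hx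
  · rcases lt_trichotomy (g.eval y) 0 with hy | hy | hy
    · rw [sign_neg hx, sign_neg hy]
    · exact absurd (M.swap.eval_eq_zero hK hF h' hy) hx.ne
    · exact (M.swap.not_pos_neg hK hF h' hy hx).elim
  · rw [hx, M.eval_eq_zero hF hK h hx, sign_zero, sign_zero]
  · rcases lt_trichotomy (g.eval y) 0 with hy | hy | hy
    · exact (M.not_pos_neg hF hK h hx hy).elim
    · exact absurd (M.swap.eval_eq_zero hK hF h' hy) hx.ne'
    · rw [sign_pos hx, sign_pos hy]

end Matched

end SignTables

end ToricMoment

namespace ToricMoment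

open Polynomial

section Elimination

variable {A : Type*} [CommRing A]

theorem exists_pseudo_rem (p q : A[X]) (hq : q.natDegree ≠ 0) :
    ∃ (e : ℕ) (r s : A[X]), C q.leadingCoeff ^ e * p = q * s + r ∧ r.natDegree < q.natDegree := by
  suffices H : ∀ n (p : A[X]), p.natDegree = n → ∃ (e : ℕ) (r s : A[X]),
      C q.leadingCoeff ^ e * p = q * s + r ∧ r.natDegree < q.natDegree from H _ p rfl
  clear p
  intro n
  induction n using Nat.strong_induction_on with
  | _ n ih =>
    intro p hp
    rcases lt_or_ge p.natDegree q.natDegree with h | h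
    · exact ⟨0, p, 0, by simp, h⟩
    set m := p.natDegree - q.natDegree with hm
    set p' := C q.leadingCoeff * p - C p.leadingCoeff * X ^ m * q with hp'
    have hdeg : p'.natDegree ≤ p.natDegree - 1 := by
      refine natDegree_le_pred ?_ ?_
      · refine (natDegree_sub_le _ _).trans (max_le (natDegree_C_mul_le _ _) ?_)
        refine natDegree_mul_le.trans ?_
        have := natDegree_C_mul_X_pow_le p.leadingCoeff m
        omega
      · have h1 : p.natDegree = q.natDegree + m := by omega
        rw [hp', coeff_sub, coeff_C_mul, mul_assoc, coeff_C_mul, mul_comm (X ^ m) q]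
        conv_lhs => rw [h1]
        rw [coeff_mul_X_pow, ← h1, coeff_natDegree, coeff_natDegree]
        ring
    obtain ⟨e, r, s, h1, h2⟩ := ih p'.natDegree (by omega) p' rfl
    refine ⟨e + 1, r, s + C q.leadingCoeff ^ e * C p.leadingCoeff * X ^ m, ?_, h2⟩
    rw [hp'] at h1
    linear_combination h1

theorem exists_even_pseudo_rem (p q : A[X]) (hq : q.natDegree ≠ 0) :
    ∃ r : A[X], r.natDegree < q.natDegree ∧
      ∃ (e : ℕ) (s : A[X]), C q.leadingCoeff ^ (2 * e) * p = q * s + r := by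
  obtain ⟨e, r, s, h, hr⟩ := exists_pseudo_rem p q hq
  refine ⟨C (q.leadingCoeff ^ e) * r, (natDegree_C_mul_le _ _).trans_lt hr, e,
    C q.leadingCoeff ^ e * s, ?_⟩
  rw [C_pow]
  linear_combination C q.leadingCoeff ^ e * h

open Classical in
/-- A remainder of `p` modulo `q` after multiplication by an even power of the leading
coefficient of `q`; zero if `q` is constant. -/
noncomputable def pseudoRem (p q : A[X]) : A[X] :=
  if hq : q.natDegree ≠ 0 then (exists_even_pseudo_rem p q hq).choose else 0

theorem pseudoRem_spec (p q : A[X]) (hq : q.natDegree ≠ 0) :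
    (pseudoRem p q).natDegree < q.natDegree ∧
      ∃ (e : ℕ) (s : A[X]), C q.leadingCoeff ^ (2 * e) * p = q * s + pseudoRem p q := by
  rw [pseudoRem, dif_pos hq]
  exact (exists_even_pseudo_rem p q hq).choose_spec

theorem pseudoRem_natDegree_lt (p : A[X]) {t : A[X]} {d : ℕ} (hd : d ≠ 0) (ht : t.natDegree ≤ d) :
    (pseudoRem p t).natDegree < d := by
  by_cases h : t.natDegree = 0
  · rw [pseudoRem, dif_neg (not_not.2 h), natDegree_zero]; omega
  · exact (pseudoRem_spec p t h).1.trans_le ht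

open Classical in
/-- The polynomials obtained from `q` by repeatedly erasing the leading term. -/
noncomputable def truncations (q : A[X]) : Finset A[X] :=
  (Finset.range (q.support.card + 1)).image fun j => eraseLead^[j] q

theorem natDegree_of_mem_truncations {q t : A[X]} (ht : t ∈ truncations q) :
    t.natDegree ≤ q.natDegree := by
  classical
  obtain ⟨j, -, rfl⟩ := Finset.mem_image.1 ht
  clear ht
  induction j with
  | zero => rfl
  | succ j ih =>
    rw [Function.iterate_succ_apply']
    exact (eraseLead_natDegree_le_aux).trans ih

theorem map_eraseLead_eq {B : Type*} [CommRing B] (φ : A →+* B) (q : A[X])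
    (h : φ q.leadingCoeff = 0) : q.eraseLead.map φ = q.map φ := by
  conv_rhs => rw [← eraseLead_add_C_mul_X_pow q]
  rw [Polynomial.map_add, Polynomial.map_mul, map_C, h, C_0, zero_mul, add_zero]

theorem exists_truncation {B B' : Type*} [CommRing B] [CommRing B'] (φ : A →+* B) (ψ : A →+* B')
    (q : A[X]) (hq : q.map φ ≠ 0)
    (h : ∀ t ∈ truncations q, φ t.leadingCoeff = 0 → ψ t.leadingCoeff = 0) :
    ∃ t ∈ truncations q, t.map φ = q.map φ ∧ t.map ψ = q.map ψ ∧ φ t.leadingCoeff ≠ 0 := by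
  classical
  simp only [truncations, Finset.mem_image, Finset.mem_range, exists_exists_and_eq_and,
    forall_exists_index, and_imp] at h ⊢
  suffices H : ∀ n (q : A[X]), q.support.card ≤ n → q.map φ ≠ 0 →
      (∀ j < n + 1, φ (eraseLead^[j] q).leadingCoeff = 0 → ψ (eraseLead^[j] q).leadingCoeff = 0) →
      ∃ j < n + 1, (eraseLead^[j] q).map φ = q.map φ ∧ (eraseLead^[j] q).map ψ = q.map ψ ∧
        φ (eraseLead^[j] q).leadingCoeff ≠ 0 from
    H _ q le_rfl hq fun j hj => h _ j hj rfl
  clear h hq q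
  intro n
  induction n with
  | zero =>
    intro q hc hq
    have : q = 0 := by simpa using hc
    simp [this] at hq
  | succ n ih =>
    intro q hc hq h
    by_cases h0 : φ q.leadingCoeff = 0
    · have h1 := map_eraseLead_eq φ q h0
      have h2 := map_eraseLead_eq ψ q (h 0 (by omega) h0)
      have hq0 : q ≠ 0 := by rintro rfl; simp at hq
      have hlt := eraseLead_support_card_lt hq0
      obtain ⟨j, hj, h3, h4, h5⟩ := ih q.eraseLead (by omega) (by rwa [h1])
        (fun j hj => by simpa [Function.iterate_succ_apply] using h (j + 1) (by omega))
      exact ⟨j + 1, by omega, by rw [Function.iterate_succ_apply, h3, h1],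
        by rw [Function.iterate_succ_apply, h4, h2], h5⟩
    · exact ⟨0, by omega, rfl, rfl, h0⟩

variable {F K : Type*} [Field F] [LinearOrder F] [IsStrictOrderedRing F]
  [Field K] [LinearOrder K] [IsStrictOrderedRing K]

/-- Two ring homomorphisms to ordered fields agree in sign on a set. -/
def Agree (φ : A →+* F) (ψ : A →+* K) (R : Finset A) : Prop :=
  ∀ r ∈ R, SignType.sign (φ r) = SignType.sign (ψ r)

theorem Agree.mono {φ : A →+* F} {ψ : A →+* K} {R R' : Finset A} (h : Agree φ ψ R)
    (hR : R' ⊆ R) : Agree φ ψ R' := fun r hr => h r (hR hr)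

theorem Agree.eq_zero_iff {φ : A →+* F} {ψ : A →+* K} {R : Finset A} (h : Agree φ ψ R) {r : A}
    (hr : r ∈ R) : φ r = 0 ↔ ψ r = 0 := by
  rw [← sign_eq_zero_iff, h r hr, sign_eq_zero_iff]

/-- `G` pairs the roots of the polynomials in `Q` over `F` with those over `K`, and all
polynomials in `Q` have equal signs on corresponding cuts. -/
structure SignTable (φ : A →+* F) (ψ : A →+* K) (Q : Finset A[X]) (G : Set (F × K)) : Prop where
  finite : G.Finite
  cut : ∀ z ∈ G, SameCut G z.1 z.2
  root_left : ∀ q ∈ Q, q.map φ ≠ 0 → ∀ x, (q.map φ).eval x = 0 → ∃ y, (x, y) ∈ G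
  root_right : ∀ q ∈ Q, q.map ψ ≠ 0 → ∀ y, (q.map ψ).eval y = 0 → ∃ x, (x, y) ∈ G
  exact : ∀ z ∈ G, ∃ q ∈ Q, q.map φ ≠ 0 ∧ q.map ψ ≠ 0 ∧ (q.map φ).eval z.1 = 0 ∧
    (q.map ψ).eval z.2 = 0
  sign : ∀ x y, SameCut G x y → ∀ q ∈ Q,
    SignType.sign ((q.map φ).eval x) = SignType.sign ((q.map ψ).eval y)

namespace SignTable

variable {φ : A →+* F} {ψ : A →+* K} {Q Q' : Finset A[X]} {G : Set (F × K)}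

theorem swap (T : SignTable φ ψ Q G) : SignTable ψ φ Q (Prod.swap ⁻¹' G) where
  finite := T.finite.preimage Prod.swap_injective.injOn
  cut _ hz := (T.cut _ hz).swap
  root_left q hq h x hx := T.root_right q hq h x hx
  root_right q hq h x hx := T.root_left q hq h x hx
  exact z hz := by
    obtain ⟨q, hq, h1, h2, h3, h4⟩ := T.exact _ hz
    exact ⟨q, hq, h2, h1, h4, h3⟩
  sign x y h q hq := (T.sign y x h.of_swap q hq).symm

theorem map_ne_zero (T : SignTable φ ψ Q G) {q : A[X]} (hq : q ∈ Q) (h : q.map φ ≠ 0) :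
    q.map ψ ≠ 0 := by
  intro h0
  refine h (Polynomial.funext fun x => ?_)
  obtain ⟨y, hy⟩ := SameCut.exists T.finite T.cut x
  have := T.sign x y hy q hq
  rw [h0, eval_zero, sign_zero, sign_eq_zero_iff] at this
  rw [this, eval_zero]

theorem root_iff (T : SignTable φ ψ Q G) {q : A[X]} (hq : q ∈ Q) {z : F × K} (hz : z ∈ G) :
    (q.map φ).eval z.1 = 0 ↔ (q.map ψ).eval z.2 = 0 := by
  rw [← sign_eq_zero_iff, T.sign _ _ (T.cut z hz) q hq, sign_eq_zero_iff]

theorem restrict (hK : PolynomialIVT K) (T : SignTable φ ψ Q G) (h : Q' ⊆ Q) :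
    ∃ G' ⊆ G, SignTable φ ψ Q' G' := by
  set G' : Set (F × K) := {z ∈ G | ∃ q ∈ Q', q.map φ ≠ 0 ∧ q.map ψ ≠ 0 ∧
    (q.map φ).eval z.1 = 0 ∧ (q.map ψ).eval z.2 = 0} with hG'
  have hsub : G' ⊆ G := Set.sep_subset _ _
  have hright : ∀ q ∈ Q', q.map ψ ≠ 0 → ∀ y, (q.map ψ).eval y = 0 → ∃ x, (x, y) ∈ G' := by
    intro q hq h0 y hy
    obtain ⟨x, hx⟩ := T.root_right q (h hq) h0 y hy
    exact ⟨x, hx, q, hq, T.swap.map_ne_zero (h hq) h0, h0, (T.root_iff (h hq) hx).2 hy, hy⟩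
  refine ⟨G', hsub, T.finite.subset hsub, fun z hz => (T.cut z (hsub hz)).mono hsub,
    fun q hq h0 x hx => ?_, hright, fun z hz => hz.2, fun x y hxy q hq => ?_⟩
  · obtain ⟨y, hy⟩ := T.root_left q (h hq) h0 x hx
    exact ⟨y, hy, q, hq, h0, T.map_ne_zero (h hq) h0, hx, (T.root_iff (h hq) hy).1 hx⟩
  · obtain ⟨y', hy'⟩ := SameCut.exists T.finite T.cut x
    rw [T.sign x y' hy' q (h hq)]
    have hxy' := hy'.mono hsub
    by_cases h0 : q.map ψ = 0
    · simp [h0]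
    rcases le_total y y' with hle | hle
    · by_cases hr : ∀ c ∈ Set.Icc y y', (q.map ψ).eval c ≠ 0
      · exact (hK.sign_eq hle hr).symm
      · push Not at hr
        obtain ⟨c, hc, hc0⟩ := hr
        obtain ⟨w, hw⟩ := hright q hq h0 c hc0
        have h1 : ¬ w < x := fun hlt => ((hxy _ hw).1.1 hlt).not_ge hc.1
        have h2 : ¬ x < w := fun hlt => ((hxy' _ hw).2.1 hlt).not_ge hc.2
        obtain rfl := le_antisymm (not_lt.1 h1) (not_lt.1 h2)
        rw [hxy.eq_right hw, hxy'.eq_right hw]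
    · by_cases hr : ∀ c ∈ Set.Icc y' y, (q.map ψ).eval c ≠ 0
      · exact hK.sign_eq hle hr
      · push Not at hr
        obtain ⟨c, hc, hc0⟩ := hr
        obtain ⟨w, hw⟩ := hright q hq h0 c hc0
        have h1 : ¬ w < x := fun hlt => ((hxy' _ hw).1.1 hlt).not_ge hc.1
        have h2 : ¬ x < w := fun hlt => ((hxy _ hw).2.1 hlt).not_ge hc.2
        obtain rfl := le_antisymm (not_lt.1 h2) (not_lt.1 h1)
        rw [hxy.eq_right hw, hxy'.eq_right hw]

theorem insert_of_map_eq [DecidableEq A[X]] (T : SignTable φ ψ Q G) {p q : A[X]} (hq : q ∈ Q)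
    (h1 : q.map φ = p.map φ) (h2 : q.map ψ = p.map ψ) : SignTable φ ψ (insert p Q) G where
  finite := T.finite
  cut := T.cut
  root_left := by
    intro t ht
    rcases Finset.mem_insert.1 ht with rfl | ht
    · rw [← h1]; exact T.root_left q hq
    · exact T.root_left t ht
  root_right := by
    intro t ht
    rcases Finset.mem_insert.1 ht with rfl | ht
    · rw [← h2]; exact T.root_right q hq
    · exact T.root_right t ht
  exact z hz := by
    obtain ⟨t, ht, h⟩ := T.exact z hz
    exact ⟨t, Finset.mem_insert_of_mem ht, h⟩
  sign := by
    intro x y hxy t ht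
    rcases Finset.mem_insert.1 ht with rfl | ht
    · rw [← h1, ← h2]; exact T.sign x y hxy q hq
    · exact T.sign x y hxy t ht

theorem insert_of_derivative_mem [DecidableEq A[X]] (hF : PolynomialIVT F) (hK : PolynomialIVT K)
    (T : SignTable φ ψ Q G) {p : A[X]} (hp : derivative p ∈ Q) (h0 : (derivative p).map φ ≠ 0)
    (hsign : ∀ z ∈ G, SignType.sign ((p.map φ).eval z.1) = SignType.sign ((p.map ψ).eval z.2)) :
    ∃ G', SignTable φ ψ (insert p Q) G' := by
  have h0' := T.map_ne_zero hp h0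
  have hpφ : p.map φ ≠ 0 := by intro h; rw [← derivative_map, h, derivative_zero] at h0; simp at h0
  have hpψ : p.map ψ ≠ 0 := by
    intro h; rw [← derivative_map, h, derivative_zero] at h0'; simp at h0'
  have M : Matched G (p.map φ) (p.map ψ) :=
    { finite := T.finite
      cut := T.cut
      sign := hsign
      der := fun x y h => by simpa [derivative_map] using T.sign x y h _ hp
      root_left := fun x hx => T.root_left _ hp h0 x (by simpa [derivative_map] using hx)
      root_right := fun x hx => T.root_right _ hp h0' x (by simpa [derivative_map] using hx) }
  refine ⟨Matched.extend G (p.map φ) (p.map ψ), M.extend_finite hpφ hpψ,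
    fun z hz => M.extend_cut hF hK hz, ?_, ?_, ?_, ?_⟩
  · intro t ht ht0 x hx
    rcases Finset.mem_insert.1 ht with rfl | ht
    · obtain ⟨y, hy, hc⟩ := M.exists_paired_root hF hK hx
      exact ⟨y, Or.inr ⟨hx, hy, hc⟩⟩
    · obtain ⟨y, hy⟩ := T.root_left t ht ht0 x hx
      exact ⟨y, Or.inl hy⟩
  · intro t ht ht0 y hy
    rcases Finset.mem_insert.1 ht with rfl | ht
    · obtain ⟨x, hx, hc⟩ := M.swap.exists_paired_root hK hF hy
      exact ⟨x, Or.inr ⟨hx, hy, hc.of_swap⟩⟩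
    · obtain ⟨x, hx⟩ := T.root_right t ht ht0 y hy
      exact ⟨x, Or.inl hx⟩
  · rintro z (hz | ⟨h1, h2, -⟩)
    · obtain ⟨t, ht, h⟩ := T.exact z hz
      exact ⟨t, Finset.mem_insert_of_mem ht, h⟩
    · exact ⟨p, Finset.mem_insert_self _ _, hpφ, hpψ, h1, h2⟩
  · intro x y hxy t ht
    rcases Finset.mem_insert.1 ht with rfl | ht
    · exact M.extend_sign hF hK hxy
    · exact T.sign x y (hxy.mono Set.subset_union_left) t ht

end SignTable

theorem sign_eq_of_pseudoRem {φ : A →+* F} {p q : A[X]} (hq : q.natDegree ≠ 0)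
    (hlc : φ q.leadingCoeff ≠ 0) {x : F} (hx : (q.map φ).eval x = 0) :
    SignType.sign ((p.map φ).eval x) = SignType.sign (((pseudoRem p q).map φ).eval x) := by
  obtain ⟨-, e, s, h⟩ := pseudoRem_spec p q hq
  have h1 := congrArg (fun t => (t.map φ).eval x) h
  simp only [Polynomial.map_mul, Polynomial.map_pow, map_C, eval_mul, eval_pow, eval_C,
    Polynomial.map_add, eval_add, hx, zero_mul, zero_add] at h1
  rw [← h1, sign_mul, pow_mul, sign_pos (a := (φ q.leadingCoeff ^ 2) ^ e) (by positivity), one_mul]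

variable (F K) in
/-- A finite set of polynomials has a sign table as soon as finitely many elements of the
coefficient ring have equal signs. -/
def HasSignTables (Q : Finset A[X]) : Prop :=
  ∃ R : Finset A, ∀ (φ : A →+* F) (ψ : A →+* K), Agree φ ψ R → ∃ G, SignTable φ ψ Q G

theorem HasSignTables.mono (hK : PolynomialIVT K) {Q Q' : Finset A[X]}
    (h : HasSignTables F K Q) (hQ : Q' ⊆ Q) : HasSignTables F K Q' := by
  obtain ⟨R, hR⟩ := h
  refine ⟨R, fun φ ψ hA => ?_⟩
  obtain ⟨G, T⟩ := hR φ ψ hA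
  obtain ⟨G', -, T'⟩ := T.restrict hK hQ
  exact ⟨G', T'⟩

open Classical in
theorem HasSignTables.insert_of_pseudoRem (hF : PolynomialIVT F) (hK : PolynomialIVT K) {Q : Finset A[X]}
    {p : A[X]} (hp : p.natDegree ≠ 0) {Q₁ : Finset A[X]}
    (hQ₁ : Q₁ = insert (derivative p) (insert p.eraseLead Q))
    (h : HasSignTables F K (Q₁ ∪ (Q₁.biUnion truncations).image (pseudoRem p))) :
    HasSignTables F K (insert p Q) := by
  obtain ⟨R, hR⟩ := h
  refine ⟨R ∪ insert p.leadingCoeff ((Q₁.biUnion truncations).image leadingCoeff),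
    fun φ ψ hA => ?_⟩
  obtain ⟨G₂, T₂⟩ := hR φ ψ (hA.mono Finset.subset_union_left)
  obtain ⟨G₁, hG, T₁⟩ := T₂.restrict hK Finset.subset_union_left
  have hsub : insert p Q ⊆ insert p Q₁ := by
    rw [hQ₁]
    exact Finset.insert_subset_insert _
      ((Finset.subset_insert _ _).trans (Finset.subset_insert _ _))
  by_cases h0 : φ p.leadingCoeff = 0
  · have h0' := (hA.eq_zero_iff (by simp)).1 h0
    obtain ⟨G', -, T'⟩ := (T₁.insert_of_map_eq (p := p) (q := p.eraseLead) (by simp [hQ₁])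
      (map_eraseLead_eq φ p h0) (map_eraseLead_eq ψ p h0')).restrict hK hsub
    exact ⟨G', T'⟩
  · have hder : (derivative p).map φ ≠ 0 := by
      intro hd
      rw [← derivative_map] at hd
      have := derivative_eq_zero.1 hd
      rw [natDegree_map_of_leadingCoeff_ne_zero φ h0] at this
      exact hp this
    obtain ⟨G', T'⟩ := T₁.insert_of_derivative_mem hF hK (p := p) (by simp [hQ₁]) hder (by
      intro z hz
      obtain ⟨q, hq, hqφ, -, hz1, hz2⟩ := T₁.exact z hz
      have hlcR : ∀ t ∈ truncations q, t.leadingCoeff ∈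
          R ∪ insert p.leadingCoeff ((Q₁.biUnion truncations).image leadingCoeff) :=
        fun t ht => Finset.mem_union_right _ (Finset.mem_insert_of_mem
          (Finset.mem_image_of_mem _ (Finset.mem_biUnion.2 ⟨q, hq, ht⟩)))
      obtain ⟨t, ht, h1, h2, h3⟩ := exists_truncation φ ψ q hqφ
        (fun t ht => (hA.eq_zero_iff (hlcR t ht)).1)
      rw [← h1] at hz1 hqφ
      rw [← h2] at hz2
      have htd : t.natDegree ≠ 0 := by
        intro htd
        obtain ⟨c, rfl⟩ := natDegree_eq_zero.1 htd
        simp at hz1 hqφ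
        exact hqφ hz1
      rw [sign_eq_of_pseudoRem htd h3 hz1, sign_eq_of_pseudoRem htd
        (fun h => h3 ((hA.eq_zero_iff (hlcR t ht)).2 h)) hz2]
      exact T₂.sign _ _ (T₂.cut z (hG hz)) _ (Finset.mem_union_right _
        (Finset.mem_image_of_mem _ (Finset.mem_biUnion.2 ⟨q, hq, ht⟩))))
    obtain ⟨G'', -, T''⟩ := T'.restrict hK hsub
    exact ⟨G'', T''⟩

theorem hasSignTables_of_natDegree_eq_zero (Q : Finset A[X]) (hQ : ∀ q ∈ Q, q.natDegree = 0) :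
    HasSignTables F K Q := by
  classical
  refine ⟨Q.image (coeff · 0), fun φ ψ hA => ⟨∅, Set.finite_empty, by simp, ?_, ?_, by simp, ?_⟩⟩
  · intro q hq h0 x hx
    obtain ⟨c, rfl⟩ := natDegree_eq_zero.1 (hQ q hq)
    simp at h0 hx
    exact absurd hx h0
  · intro q hq h0 x hx
    obtain ⟨c, rfl⟩ := natDegree_eq_zero.1 (hQ q hq)
    simp at h0 hx
    exact absurd hx h0
  · intro x y _ q hq
    have h := hA _ (Finset.mem_image_of_mem _ hq)
    obtain ⟨c, rfl⟩ := natDegree_eq_zero.1 (hQ q hq)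
    simpa using h

theorem hasSignTables (hF : PolynomialIVT F) (hK : PolynomialIVT K) (Q : Finset A[X]) :
    HasSignTables F K Q := by
  classical
  suffices H : ∀ (d : ℕ) (Q : Finset A[X]), (∀ q ∈ Q, q.natDegree < d) → HasSignTables F K Q from
    H (Q.sup natDegree + 1) Q fun q hq => Nat.lt_succ_of_le (Finset.le_sup (f := natDegree) hq)
  clear Q
  intro d
  induction d with
  | zero =>
    exact fun Q hQ => hasSignTables_of_natDegree_eq_zero Q fun q hq => absurd (hQ q hq) (by omega)
  | succ d ih =>
    by_cases hd : d = 0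
    · exact fun Q hQ => hasSignTables_of_natDegree_eq_zero Q fun q hq => by have := hQ q hq; omega
    suffices H : ∀ P : Finset A[X], (∀ q ∈ P, q.natDegree = d) → ∀ L : Finset A[X],
        (∀ q ∈ L, q.natDegree < d) → HasSignTables F K (P ∪ L) by
      intro Q hQ
      refine (H (Q.filter (·.natDegree = d)) (by simp) (Q.filter (·.natDegree < d))
        (by simp)).mono hK fun q hq => ?_
      have := hQ q hq
      simp only [Finset.mem_union, Finset.mem_filter, hq, true_and]
      omega
    intro P
    induction P using Finset.induction_on with
    | empty => intro _ L hL; rw [Finset.empty_union]; exact ih L hL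
    | insert p P _ ihP =>
      intro hP L hL
      have hpd := hP p (Finset.mem_insert_self _ _)
      have hPd : ∀ q ∈ P, q.natDegree = d := fun q hq => hP q (Finset.mem_insert_of_mem hq)
      rw [Finset.insert_union]
      set Q₁ := insert (derivative p) (insert p.eraseLead (P ∪ L)) with hQ₁
      have h1 : ∀ q ∈ Q₁, q ∈ P ∨ q.natDegree < d := by
        intro q hq
        simp only [hQ₁, Finset.mem_insert, Finset.mem_union] at hq
        rcases hq with rfl | rfl | hq | hq
        · have := natDegree_derivative_le p; omega
        · have := eraseLead_natDegree_le p; omega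
        · exact Or.inl hq
        · exact Or.inr (hL q hq)
      refine HasSignTables.insert_of_pseudoRem hF hK (by omega) hQ₁ ?_
      set Q₂ := Q₁ ∪ (Q₁.biUnion truncations).image (pseudoRem p) with hQ₂
      refine (ihP hPd (Q₂.filter (·.natDegree < d)) (by simp)).mono hK fun q hq => ?_
      simp only [Finset.mem_union, Finset.mem_filter, hq, true_and]
      rw [hQ₂, Finset.mem_union, Finset.mem_image] at hq
      rcases hq with hq | ⟨t, ht, rfl⟩
      · exact h1 q hq
      · obtain ⟨q, hq, ht⟩ := Finset.mem_biUnion.1 ht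
        refine Or.inr (pseudoRem_natDegree_lt p hd ((natDegree_of_mem_truncations ht).trans ?_))
        rcases h1 q hq with h | h
        · exact (hPd q h).le
        · exact h.le

end Elimination

section Transfer

universe w
variable {A B B' : Type w} [CommRing A] [CommRing B] [CommRing B']
variable (F K : Type*) [Field F] [LinearOrder F] [IsStrictOrderedRing F]
  [Field K] [LinearOrder K] [IsStrictOrderedRing K]

/-- Extensions to `B` of a homomorphism `A → F` can be imitated over `K`, for any finite set of
sign conditions, along every homomorphism `A → K` that satisfies suitable finitely many sign
conditions. -/
def TransferExt (ι : A →+* B) : Prop :=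
  ∀ Q : Finset B, ∃ R : Finset A, ∀ (φ : A →+* F) (ψ : A →+* K), Agree φ ψ R →
    ∀ Φ : B →+* F, Φ.comp ι = φ → ∃ Ψ : B →+* K, Ψ.comp ι = ψ ∧ Agree Φ Ψ Q

variable {F K}

theorem TransferExt.comp {ι : A →+* B} {κ : B →+* B'} (hκ : TransferExt F K κ)
    (hι : TransferExt F K ι) : TransferExt F K (κ.comp ι) := by
  intro Q
  obtain ⟨R, hR⟩ := hκ Q
  obtain ⟨R', hR'⟩ := hι R
  refine ⟨R', fun φ ψ h Φ hΦ => ?_⟩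
  obtain ⟨Ψ₁, h1, h2⟩ := hR' φ ψ h (Φ.comp κ) (by rw [RingHom.comp_assoc, hΦ])
  obtain ⟨Ψ, h3, h4⟩ := hR _ _ h2 Φ rfl
  exact ⟨Ψ, by rw [← RingHom.comp_assoc, h3, h1], h4⟩

theorem transferExt_equiv (e : A ≃+* B) : TransferExt F K (e : A →+* B) := by
  classical
  refine fun Q => ⟨Q.image e.symm, fun φ ψ h Φ hΦ => ⟨ψ.comp (e.symm : B →+* A), ?_, ?_⟩⟩
  · ext x; simp
  · intro q hq
    have := h _ (Finset.mem_image_of_mem _ hq)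
    rw [← hΦ] at this
    simpa using this

theorem transferExt_polynomial (hF : PolynomialIVT F) (hK : PolynomialIVT K) :
    TransferExt F K (C : A →+* A[X]) := by
  intro Q
  obtain ⟨R, hR⟩ := hasSignTables hF hK Q
  refine ⟨R, fun φ ψ h Φ hΦ => ?_⟩
  obtain ⟨G, T⟩ := hR φ ψ h
  obtain ⟨y, hy⟩ := SameCut.exists T.finite T.cut (Φ X)
  refine ⟨eval₂RingHom ψ y, by ext; simp, fun q hq => ?_⟩
  have h1 : Φ q = (q.map φ).eval (Φ X) := by
    have : Φ = eval₂RingHom φ (Φ X) := by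
      ext x
      · simpa using congrArg (fun f : A →+* F => f x) hΦ
      · simp
    rw [eval_map]
    exact congrArg (fun f : A[X] →+* F => f q) this
  rw [h1, coe_eval₂RingHom, ← eval_map]
  exact T.sign _ _ hy q hq

theorem transferExt_mvPolynomial (hF : PolynomialIVT F) (hK : PolynomialIVT K)
    (σ : Type w) [Finite σ] : TransferExt F K (MvPolynomial.C : A →+* MvPolynomial σ A) := by
  induction σ using Finite.induction_empty_option with
  | of_equiv e h =>
    have := (transferExt_equiv (F := F) (K := K)
      (MvPolynomial.renameEquiv A e).toRingEquiv).comp h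
    convert this using 1
    ext x; simp
  | h_empty =>
    have := transferExt_equiv (F := F) (K := K)
      (MvPolynomial.isEmptyAlgEquiv A PEmpty).symm.toRingEquiv
    convert this using 1
    ext x; simp
  | h_option h =>
    rename_i σ _
    have := (transferExt_equiv (F := F) (K := K)
      (MvPolynomial.optionEquivLeft A σ).symm.toRingEquiv).comp
      ((transferExt_polynomial hF hK).comp h)
    convert this using 1
    ext x; simp [MvPolynomial.optionEquivLeft_symm_apply]

end Transfer

end ToricMoment

namespace ToricMoment

open Filter Topology

section Entropy

theorem entropy_tangent_le {c x y : ℝ} (hc : 0 < c) (hx : 0 ≤ x) (hy : 0 < y) :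
    (y * Real.log y - y * Real.log c - y) + Real.log (y / c) * (x - y) ≤
      x * Real.log x - x * Real.log c - x := by
  rw [Real.log_div hy.ne' hc.ne']
  rcases hx.eq_or_lt with rfl | hx
  · simp only [zero_mul]; nlinarith
  · have h := Real.log_le_sub_one_of_pos (div_pos hy hx)
    rw [Real.log_div hy.ne' hx.ne'] at h
    have h2 := mul_le_mul_of_nonneg_left h hx.le
    have h3 : x * (y / x - 1) = y - x := by field_simp
    rw [h3] at h2
    nlinarith

variable {J ι : Type*} [Fintype J] (a : J → ι → ℤ) (c lam : J → ℝ)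

/-- The nonnegative vectors with the same weighted sum of the `a j` as `lam`. -/
def feasibleSet : Set (J → ℝ) :=
  {p | (∀ j, 0 ≤ p j) ∧ ∀ l, ∑ j, p j * a j l = ∑ j, lam j * a j l}

/-- Relative entropy of `p` with respect to `c`. -/
noncomputable def entropy (p : J → ℝ) : ℝ :=
  ∑ j, (p j * Real.log (p j) - p j * Real.log (c j) - p j)

variable {a c lam}

theorem isCompact_feasibleSet {l₀ : ι} (h₀ : ∀ j, a j l₀ = 1) :
    IsCompact (feasibleSet a lam) := by
  refine (isCompact_Icc (a := (0 : J → ℝ)) (b := fun _ => ∑ j, lam j)).of_isClosed_subset ?_ ?_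
  · have : feasibleSet a lam = (⋂ j, {p : J → ℝ | 0 ≤ p j}) ∩
        ⋂ l, {p : J → ℝ | ∑ j, p j * a j l = ∑ j, lam j * a j l} := by
      ext p; simp [feasibleSet]
    rw [this]
    exact (isClosed_iInter fun j => isClosed_le continuous_const (continuous_apply j)).inter
      (isClosed_iInter fun l => isClosed_eq (by fun_prop) continuous_const)
  · rintro p ⟨hp, hs⟩
    refine ⟨hp, fun j => ?_⟩
    have := hs l₀
    simp only [h₀, Int.cast_one, mul_one] at this
    rw [← this]
    exact Finset.single_le_sum (fun j _ => hp j) (Finset.mem_univ j)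

theorem exists_entropy_min {l₀ : ι} (h₀ : ∀ j, a j l₀ = 1) (hlam : ∀ j, 0 ≤ lam j) :
    ∃ p ∈ feasibleSet a lam, ∀ p' ∈ feasibleSet a lam, entropy c p ≤ entropy c p' := by
  have hcont : Continuous (entropy c) := by
    refine continuous_finsetSum _ fun j _ => ?_
    exact ((Real.continuous_mul_log.comp (continuous_apply j)).sub
      ((continuous_apply j).mul continuous_const)).sub (continuous_apply j)
  exact (isCompact_feasibleSet h₀).exists_isMinOn ⟨lam, hlam, fun _ => rfl⟩ hcont.continuousOn

section Minimizer

variable {p p' : J → ℝ} (hc : ∀ j, 0 < c j) (hp : p ∈ feasibleSet a lam)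
  (hmin : ∀ p' ∈ feasibleSet a lam, entropy c p ≤ entropy c p') (hp' : p' ∈ feasibleSet a lam)

include hc hp hmin hp'

theorem entropy_directional_nonneg {t : ℝ} (ht : 0 < t) (ht1 : t < 1) :
    0 ≤ ∑ j, (p' j - p j) * Real.log ((p j + t * (p' j - p j)) / c j) := by
  have hy0 : ∀ j, 0 ≤ p j + t * (p' j - p j) := fun j => by
    have h1 := mul_nonneg (sub_nonneg.2 ht1.le) (hp.1 j)
    have h2 := mul_nonneg ht.le (hp'.1 j)
    linarith
  have hy : (fun j => p j + t * (p' j - p j)) ∈ feasibleSet a lam := by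
    refine ⟨hy0, fun l => ?_⟩
    have h1 := hp.2 l
    have h2 := hp'.2 l
    calc ∑ j, (p j + t * (p' j - p j)) * (a j l : ℝ)
        = (1 - t) * ∑ j, p j * (a j l : ℝ) + t * ∑ j, p' j * (a j l : ℝ) := by
          rw [Finset.mul_sum, Finset.mul_sum, ← Finset.sum_add_distrib]
          exact Finset.sum_congr rfl fun j _ => by ring
      _ = _ := by rw [h1, h2]; ring
  have key := hmin _ hy
  have hterm : entropy c (fun j => p j + t * (p' j - p j)) - entropy c p ≤
      ∑ j, t * ((p' j - p j) * Real.log ((p j + t * (p' j - p j)) / c j)) := by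
    rw [entropy, entropy, ← Finset.sum_sub_distrib]
    refine Finset.sum_le_sum fun j _ => ?_
    rcases (hy0 j).eq_or_lt with h0 | h0
    · have h1 := mul_nonneg (sub_nonneg.2 ht1.le) (hp.1 j)
      have h2 := mul_nonneg ht.le (hp'.1 j)
      have h3 : (1 - t) * p j = 0 := by linarith
      have h4 : t * p' j = 0 := by linarith
      have h5 : p j = 0 := (mul_eq_zero.1 h3).resolve_left (by linarith)
      have h6 : p' j = 0 := (mul_eq_zero.1 h4).resolve_left ht.ne'
      simp [h5, h6]
    · have := entropy_tangent_le (hc j) (hp.1 j) h0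
      linarith
  rw [← Finset.mul_sum] at hterm
  exact nonneg_of_mul_nonneg_right (by linarith) ht

theorem support_minimizer {j₀ : J} (hj : 0 < p' j₀) : 0 < p j₀ := by
  classical
  by_contra hneg
  have hj0 : p j₀ = 0 := le_antisymm (not_lt.1 hneg) (hp.1 j₀)
  have hbot : ∀ j, p j = 0 → 0 < p' j → Tendsto
      (fun t : ℝ => (p' j - p j) * Real.log ((p j + t * (p' j - p j)) / c j)) (𝓝[>] 0) atBot := by
    intro j h0 h1
    simp only [h0, sub_zero, zero_add]
    refine Tendsto.const_mul_atBot h1 (Real.tendsto_log_nhdsGT_zero.comp ?_)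
    refine tendsto_nhdsWithin_iff.2 ⟨?_, ?_⟩
    · have : Tendsto (fun t : ℝ => t * p' j / c j) (𝓝 0) (𝓝 (0 * p' j / c j)) :=
        ((continuous_id.mul continuous_const).div_const _).tendsto 0
      rw [zero_mul, zero_div] at this
      exact this.mono_left nhdsWithin_le_nhds
    · filter_upwards [self_mem_nhdsWithin] with t ht
      exact div_pos (mul_pos ht h1) (hc j)
  have hbd : ∀ j, ∃ C, ∀ᶠ t in 𝓝[>] (0 : ℝ),
      (p' j - p j) * Real.log ((p j + t * (p' j - p j)) / c j) ≤ C := by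
    intro j
    rcases (hp.1 j).eq_or_lt with h0 | h0
    · rcases (hp'.1 j).eq_or_lt with h1 | h1
      · exact ⟨0, by simp [← h0, ← h1]⟩
      · exact ⟨0, (hbot j h0.symm h1).eventually_le_atBot 0⟩
    · have : ContinuousAt
          (fun t : ℝ => (p' j - p j) * Real.log ((p j + t * (p' j - p j)) / c j)) 0 := by
        refine continuousAt_const.mul (ContinuousAt.log (by fun_prop) ?_)
        simpa using ⟨h0.ne', (hc j).ne'⟩
      refine ⟨_, (this.tendsto.mono_left nhdsWithin_le_nhds).eventually_le_const
        (lt_add_one _)⟩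
  choose C hC using hbd
  have h1 := eventually_all.2 hC
  have h2 := (hbot j₀ hj0 hj).eventually_lt_atBot (-∑ j ∈ Finset.univ.erase j₀, C j)
  have h3 : ∀ᶠ t in 𝓝[>] (0 : ℝ), t ∈ Set.Ioo (0 : ℝ) 1 := Ioo_mem_nhdsGT one_pos
  obtain ⟨t, ht1, ht2, ht3⟩ := (h1.and (h2.and h3)).exists
  have h4 := entropy_directional_nonneg hc hp hmin hp' ht3.1 ht3.2
  rw [← Finset.add_sum_erase _ _ (Finset.mem_univ j₀)] at h4
  have h5 := Finset.sum_le_sum (s := Finset.univ.erase j₀) fun j _ => ht1 j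
  linarith

theorem entropy_derivative_nonneg : 0 ≤ ∑ j, (p' j - p j) * Real.log (p j / c j) := by
  have hlim : Tendsto (fun t : ℝ => ∑ j, (p' j - p j) *
      Real.log ((p j + t * (p' j - p j)) / c j)) (𝓝[>] 0)
      (𝓝 (∑ j, (p' j - p j) * Real.log (p j / c j))) := by
    refine tendsto_finsetSum _ fun j _ => ?_
    rcases (hp.1 j).eq_or_lt with h0 | h0
    · have h1 : p' j = 0 := le_antisymm
        (not_lt.1 fun h => (support_minimizer hc hp hmin hp' h).ne h0) (hp'.1 j)
      simp [← h0, h1]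
    · have : ContinuousAt
          (fun t : ℝ => (p' j - p j) * Real.log ((p j + t * (p' j - p j)) / c j)) 0 := by
        refine continuousAt_const.mul (ContinuousAt.log (by fun_prop) ?_)
        simpa using ⟨h0.ne', (hc j).ne'⟩
      simpa using this.tendsto.mono_left nhdsWithin_le_nhds
  refine ge_of_tendsto hlim ?_
  filter_upwards [Ioo_mem_nhdsGT (one_pos : (0 : ℝ) < 1)] with t ht
  exact entropy_directional_nonneg hc hp hmin hp' ht.1 ht.2

omit hp' in
theorem monomial_le_of_minimizer {al be : J → ℕ}
    (hab : ∀ l, ∑ j, (al j : ℤ) * a j l = ∑ j, (be j : ℤ) * a j l)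
    (hbe : ∀ j, p j = 0 → be j = 0) :
    (∀ j, p j = 0 → al j = 0) ∧ ∏ j, (p j / c j) ^ be j ≤ ∏ j, (p j / c j) ^ al j := by
  obtain ⟨ε, hε, hεp⟩ : ∃ ε > 0, ∀ j, ε * (be j : ℝ) ≤ p j := by
    have h1 : ∀ j, ∀ᶠ ε in 𝓝[>] (0 : ℝ), ε * (be j : ℝ) ≤ p j := by
      intro j
      rcases (hp.1 j).eq_or_lt with h0 | h0
      · simp [← h0, hbe j h0.symm]
      · have : Tendsto (fun ε : ℝ => ε * (be j : ℝ)) (𝓝[>] 0) (𝓝 (0 * (be j : ℝ))) :=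
          ((continuous_id.mul continuous_const).tendsto 0).mono_left nhdsWithin_le_nhds
        rw [zero_mul] at this
        exact this.eventually_le_const h0
    obtain ⟨ε, h1, h2⟩ := ((eventually_all.2 h1).and
      (self_mem_nhdsWithin : ∀ᶠ ε in 𝓝[>] (0 : ℝ), ε ∈ Set.Ioi 0)).exists
    exact ⟨ε, h2, h1⟩
  have hmem : (fun j => p j + ε * ((al j : ℝ) - be j)) ∈ feasibleSet a lam := by
    refine ⟨fun j => ?_, fun l => ?_⟩
    · have := hεp j
      have := mul_nonneg (le_of_lt hε) (Nat.cast_nonneg (α := ℝ) (al j))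
      simp only
      linarith
    · have h1 : ∑ j, (al j : ℝ) * a j l = ∑ j, (be j : ℝ) * a j l := by exact_mod_cast hab l
      rw [← hp.2 l]
      calc ∑ j, (p j + ε * ((al j : ℝ) - be j)) * (a j l : ℝ)
          = ∑ j, p j * (a j l : ℝ) + ε * (∑ j, (al j : ℝ) * a j l - ∑ j, (be j : ℝ) * a j l) := by
            rw [← Finset.sum_sub_distrib, Finset.mul_sum, ← Finset.sum_add_distrib]
            exact Finset.sum_congr rfl fun j _ => by ring
        _ = _ := by rw [h1]; ring
  have hal : ∀ j, p j = 0 → al j = 0 := by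
    intro j h0
    by_contra h
    have h1 : 0 < (al j : ℝ) := by exact_mod_cast Nat.pos_of_ne_zero h
    have := support_minimizer hc hp hmin hmem (j₀ := j) (by
      simp only [h0, hbe j h0, Nat.cast_zero, sub_zero, zero_add]
      exact mul_pos hε h1)
    exact this.ne' h0
  refine ⟨hal, ?_⟩
  have hpos : ∀ γ : J → ℕ, (∀ j, p j = 0 → γ j = 0) →
      ∏ j, (p j / c j) ^ γ j = Real.exp (∑ j, (γ j : ℝ) * Real.log (p j / c j)) := by
    intro γ hγ
    rw [Real.exp_sum]
    refine Finset.prod_congr rfl fun j _ => ?_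
    rcases (hp.1 j).eq_or_lt with h0 | h0
    · simp [hγ j h0.symm]
    · rw [Real.exp_nat_mul, Real.exp_log (div_pos h0 (hc j))]
  rw [hpos al hal, hpos be hbe, Real.exp_le_exp]
  have h := entropy_derivative_nonneg hc hp hmin hmem
  simp only [add_sub_cancel_left, mul_assoc, ← Finset.mul_sum] at h
  have h := nonneg_of_mul_nonneg_right h hε
  simp only [sub_mul, Finset.sum_sub_distrib] at h
  linarith

end Minimizer

/-- Birch's theorem over the real numbers. -/
theorem exists_toric_point_real {l₀ : ι} (h₀ : ∀ j, a j l₀ = 1) (hc : ∀ j, 0 < c j)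
    (hlam : ∀ j, 0 ≤ lam j) :
    ∃ ρ : J → ℝ, (∀ j, 0 ≤ ρ j) ∧ (∀ l, ∑ j, c j * ρ j * a j l = ∑ j, lam j * a j l) ∧
      ∀ al be : J → ℕ, (∀ l, ∑ j, (al j : ℤ) * a j l = ∑ j, (be j : ℤ) * a j l) →
        ∏ j, ρ j ^ al j = ∏ j, ρ j ^ be j := by
  obtain ⟨p, hp, hmin⟩ := exists_entropy_min (c := c) h₀ hlam
  refine ⟨fun j => p j / c j, fun j => div_nonneg (hp.1 j) (hc j).le, fun l => ?_,
    fun al be hab => ?_⟩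
  · rw [← hp.2 l]
    exact Finset.sum_congr rfl fun j _ => by rw [mul_div_cancel₀ _ (hc j).ne']
  · by_cases hbe : ∀ j, p j = 0 → be j = 0
    · obtain ⟨hal, h1⟩ := monomial_le_of_minimizer hc hp hmin hab hbe
      obtain ⟨-, h2⟩ := monomial_le_of_minimizer hc hp hmin (fun l => (hab l).symm) hal
      exact le_antisymm h2 h1
    · have hal : ¬ ∀ j, p j = 0 → al j = 0 := fun hal =>
        hbe (monomial_le_of_minimizer hc hp hmin (fun l => (hab l).symm) hal).1
      push Not at hbe hal
      obtain ⟨j, h1, h2⟩ := hbe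
      obtain ⟨j', h3, h4⟩ := hal
      rw [Finset.prod_eq_zero (Finset.mem_univ j') (by simp [h3, h4]),
        Finset.prod_eq_zero (Finset.mem_univ j) (by simp [h1, h2])]

end Entropy

section BirchTransfer

/-- Finitely many of the binomial equations of a toric variety imply all of them. -/
theorem exists_finite_binomials {J ι : Type*} [Fintype J] (a : J → ι → ℤ) :
    ∃ T : Finset ((J → ℕ) × (J → ℕ)),
      (∀ t ∈ T, ∀ l, ∑ j, (t.1 j : ℤ) * a j l = ∑ j, (t.2 j : ℤ) * a j l) ∧
      ∀ {K : Type*} [CommRing K] (ρ : J → K), (∀ t ∈ T, ∏ j, ρ j ^ t.1 j = ∏ j, ρ j ^ t.2 j) →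
        ∀ al be : J → ℕ, (∀ l, ∑ j, (al j : ℤ) * a j l = ∑ j, (be j : ℤ) * a j l) →
          ∏ j, ρ j ^ al j = ∏ j, ρ j ^ be j := by
  classical
  set D : Set ((J → ℕ) × (J → ℕ)) :=
    {t | ∀ l, ∑ j, (t.1 j : ℤ) * a j l = ∑ j, (t.2 j : ℤ) * a j l} with hD
  set b : (J → ℕ) × (J → ℕ) → MvPolynomial J ℤ :=
    fun t => ∏ j, MvPolynomial.X j ^ t.1 j - ∏ j, MvPolynomial.X j ^ t.2 j with hb
  have hfg : (Submodule.span (MvPolynomial J ℤ) (b '' D)).FG := IsNoetherian.noetherian _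
  obtain ⟨S, hS, hspan⟩ := (Submodule.fg_span_iff_fg_span_finset_subset _).1 hfg
  obtain ⟨T, hT, rfl⟩ := Finset.subset_set_image_iff.1 hS
  refine ⟨T, fun t ht => hT ht, fun {K} _ ρ hρ al be hab => ?_⟩
  have hmem : b (al, be) ∈ Submodule.span (MvPolynomial J ℤ) (b '' D) :=
    Submodule.subset_span ⟨(al, be), hab, rfl⟩
  rw [hspan] at hmem
  have hle : Submodule.span (MvPolynomial J ℤ) ((T.image b : Finset _) : Set (MvPolynomial J ℤ)) ≤
      RingHom.ker (MvPolynomial.eval₂Hom (Int.castRingHom K) ρ) := by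
    refine Submodule.span_le.2 fun x hx => ?_
    obtain ⟨t, ht, rfl⟩ := Finset.mem_image.1 (Finset.mem_coe.1 hx)
    simp [hb, RingHom.mem_ker, hρ t ht]
  have := hle hmem
  rw [RingHom.mem_ker] at this
  simpa [hb, sub_eq_zero] using this

variable {F : Type*} [Field F] [LinearOrder F] [IsStrictOrderedRing F]

/-- Birch's theorem over ordered fields with the intermediate value property. -/
theorem exists_toric_point (hF : PolynomialIVT F) {J ι : Type} [Fintype J] [Fintype ι]
    {a : J → ι → ℤ} {l₀ : ι} (h₀ : ∀ j, a j l₀ = 1) {c lam : J → F} (hc : ∀ j, 0 < c j)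
    (hlam : ∀ j, 0 ≤ lam j) :
    ∃ ρ : J → F, (∀ j, 0 ≤ ρ j) ∧ (∀ l, ∑ j, c j * ρ j * a j l = ∑ j, lam j * a j l) ∧
      ∀ al be : J → ℕ, (∀ l, ∑ j, (al j : ℤ) * a j l = ∑ j, (be j : ℤ) * a j l) →
        ∏ j, ρ j ^ al j = ∏ j, ρ j ^ be j := by
  classical
  obtain ⟨T, hT, hgen⟩ := exists_finite_binomials a
  let B := MvPolynomial (J ⊕ J) ℤ
  let x : J → MvPolynomial J B := MvPolynomial.X
  let cc : J → MvPolynomial J B := fun j => MvPolynomial.C (MvPolynomial.X (Sum.inl j))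
  let ll : J → MvPolynomial J B := fun j => MvPolynomial.C (MvPolynomial.X (Sum.inr j))
  let Q : Finset (MvPolynomial J B) := Finset.univ.image x ∪
    (Finset.univ.image fun l => ∑ j, cc j * x j * (a j l : MvPolynomial J B) -
      ∑ j, ll j * (a j l : MvPolynomial J B)) ∪
    T.image fun t => ∏ j, x j ^ t.1 j - ∏ j, x j ^ t.2 j
  obtain ⟨R, hR⟩ := transferExt_mvPolynomial (A := B) polynomialIVT_real hF J Q
  obtain ⟨R₀, hR₀⟩ := transferExt_mvPolynomial (A := ℤ) hF polynomialIVT_real (J ⊕ J)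
    (R ∪ Finset.univ.image MvPolynomial.X)
  obtain ⟨Φ, hΦ⟩ : ∃ Φ : B →+* F, ∀ s, Φ (MvPolynomial.X s) = Sum.elim c lam s :=
    ⟨MvPolynomial.eval₂Hom (Int.castRingHom F) (Sum.elim c lam), fun s =>
      MvPolynomial.eval₂Hom_X' _ _ s⟩
  obtain ⟨Ψ, -, hΨ⟩ := hR₀ (Int.castRingHom F) (Int.castRingHom ℝ)
    (fun n _ => by rw [sign_eq_sign_iff]; simp) Φ (by ext; simp)
  have hX : ∀ s, SignType.sign (Φ (MvPolynomial.X s)) = SignType.sign (Ψ (MvPolynomial.X s)) :=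
    fun s => hΨ _ (Finset.mem_union_right _ (Finset.mem_image_of_mem _ (Finset.mem_univ _)))
  obtain ⟨ρ, hρ0, hρ1, hρ2⟩ := exists_toric_point_real (a := a) h₀
    (c := fun j => Ψ (MvPolynomial.X (Sum.inl j))) (lam := fun j => Ψ (MvPolynomial.X (Sum.inr j)))
    (fun j => (sign_eq_sign_iff.1 (hX (Sum.inl j))).1.1 (by simpa [hΦ] using hc j))
    (fun j => not_lt.1 fun h => ((sign_eq_sign_iff.1 (hX (Sum.inr j))).2.2 h).not_ge
      (by simpa [hΦ] using hlam j))
  obtain ⟨Ξ, hΞC, hΞX⟩ : ∃ Ξ : MvPolynomial J B →+* ℝ, (∀ b, Ξ (MvPolynomial.C b) = Ψ b) ∧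
      ∀ j, Ξ (MvPolynomial.X j) = ρ j := ⟨MvPolynomial.eval₂Hom Ψ ρ, by simp, by simp⟩
  obtain ⟨Θ, hΘ, hA⟩ := hR Ψ Φ (fun r hr => (hΨ r (Finset.mem_union_left _ hr)).symm) Ξ
    (RingHom.ext hΞC)
  have hΘC : ∀ b, Θ (MvPolynomial.C b) = Φ b := fun b => congrArg (fun f : B →+* F => f b) hΘ
  have hzero : ∀ t ∈ Q, Ξ t = 0 → Θ t = 0 := fun t ht h0 =>
    (hA.eq_zero_iff ht).1 h0
  refine ⟨fun j => Θ (x j), fun j => ?_, fun l => ?_, hgen _ fun t ht => ?_⟩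
  · have := hA (x j) (by simp [Q])
    refine not_lt.1 fun h => ((sign_eq_sign_iff.1 this).2.2 h).not_ge ?_
    simpa [x, hΞX] using hρ0 j
  · have := hzero (∑ j, cc j * x j * (a j l : MvPolynomial J B) -
      ∑ j, ll j * (a j l : MvPolynomial J B)) (by simp [Q]) (by
        simpa [x, cc, ll, hΞX, hΞC, sub_eq_zero] using hρ1 l)
    simpa [cc, ll, hΘC, hΦ, sub_eq_zero] using this
  · have := hzero (∏ j, x j ^ t.1 j - ∏ j, x j ^ t.2 j)
      (Finset.mem_union_right _ (Finset.mem_image_of_mem _ ht)) (by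
        simpa [x, hΞX, sub_eq_zero] using hρ2 t.1 t.2 (hT t ht))
    simpa [sub_eq_zero] using this

end BirchTransfer

end ToricMoment

namespace ToricMoment


section FiniteConvexHull

variable {F : Type*} [Field F] [LinearOrder F] [IsStrictOrderedRing F]

theorem eq_of_affineIndependent {E : Type*} [AddCommGroup E] [Module F E] {t : Finset E}
    (ht : AffineIndependent F ((↑) : t → E)) {w w' : E → F} (h1 : ∑ y ∈ t, w y = ∑ y ∈ t, w' y)
    (h2 : ∑ y ∈ t, w y • y = ∑ y ∈ t, w' y • y) : ∀ y ∈ t, w y = w' y := by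
  intro y hy
  have h := affineIndependent_iff.1 ht Finset.univ (fun y => w y - w' y)
    (by rw [Finset.sum_coe_sort t (fun y => w y - w' y), Finset.sum_sub_distrib, h1, sub_self])
    (by rw [Finset.sum_coe_sort t (fun y => (w y - w' y) • y)]
        simp only [sub_smul, Finset.sum_sub_distrib]; rw [h2, sub_self]) ⟨y, hy⟩ (Finset.mem_univ _)
  exact sub_eq_zero.1 h

theorem mem_convexHull_image_iff {E J : Type*} [AddCommGroup E] [Module F E] [Fintype J]
    (g : J → E) (P : J → Prop) {v : E} : v ∈ convexHull F (g '' {j | P j}) ↔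
      ∃ lam : J → F, (∀ j, 0 ≤ lam j) ∧ (∀ j, ¬ P j → lam j = 0) ∧ ∑ j, lam j = 1 ∧
        ∑ j, lam j • g j = v := by
  classical
  constructor
  · intro hv
    refine convexHull_min (t := {v | ∃ lam : J → F, (∀ j, 0 ≤ lam j) ∧ (∀ j, ¬ P j → lam j = 0) ∧
      ∑ j, lam j = 1 ∧ ∑ j, lam j • g j = v}) ?_ ?_ hv
    · rintro _ ⟨j, hj, rfl⟩
      refine ⟨Pi.single j 1, fun j' => ?_, fun j' hj' => ?_, by simp, by simp [Pi.single_apply]⟩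
      · rw [Pi.single_apply]; split_ifs <;> simp
      · rw [Pi.single_apply, if_neg]; rintro rfl; exact hj' hj
    · rintro _ ⟨l, h1, h2, h3, rfl⟩ _ ⟨m, h1', h2', h3', rfl⟩ α β hα hβ hαβ
      refine ⟨fun j => α * l j + β * m j, fun j => ?_, fun j hj => ?_, ?_, ?_⟩
      · exact add_nonneg (mul_nonneg hα (h1 j)) (mul_nonneg hβ (h1' j))
      · simp [h2 j hj, h2' j hj]
      · rw [Finset.sum_add_distrib, ← Finset.mul_sum, ← Finset.mul_sum, h3, h3', mul_one, mul_one,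
          hαβ]
      · simp only [add_smul, mul_smul, Finset.sum_add_distrib, Finset.smul_sum]
  · rintro ⟨l, h1, h2, h3, rfl⟩
    have hne : ∀ j, j ∉ Finset.univ.filter P → l j = 0 := fun j hj => h2 j (by simpa using hj)
    rw [← Finset.sum_subset (Finset.filter_subset P Finset.univ) fun j _ hj => hne j hj] at h3
    rw [← Finset.sum_subset (Finset.filter_subset P Finset.univ) fun j _ hj => by
      rw [hne j hj, zero_smul]]
    exact (convex_convexHull F _).sum_mem (fun j _ => h1 j) h3 fun j hj =>
      subset_convexHull F _ ⟨j, by simpa using hj, rfl⟩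

section Closed

variable [TopologicalSpace F] [OrderTopology F] {ι : Type*} [Fintype ι]

theorem isClosed_convexHull_of_affineIndependent {t : Finset (ι → F)}
    (ht : AffineIndependent F ((↑) : t → ι → F)) : IsClosed (convexHull F (t : Set (ι → F))) := by
  classical
  set L : (t → F) →ₗ[F] F × (ι → F) :=
    Fintype.linearCombination F (fun y : t => ((1 : F), (y : ι → F))) with hL
  have hLapp : ∀ w, L w = (∑ y, w y, ∑ y, w y • (y : ι → F)) := by
    intro w
    rw [hL, Fintype.linearCombination_apply]
    ext <;> simp [Prod.fst_sum, Prod.snd_sum]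
  have hker : LinearMap.ker L = ⊥ := by
    refine LinearMap.ker_eq_bot'.2 fun w hw => funext fun y => ?_
    rw [hLapp, Prod.mk_eq_zero] at hw
    exact affineIndependent_iff.1 ht Finset.univ w hw.1 hw.2 y (Finset.mem_univ _)
  obtain ⟨A, hA⟩ := L.exists_leftInverse_of_injective hker
  have hAL : ∀ w, A (L w) = w := fun w => congrArg (fun f : (t → F) →ₗ[F] (t → F) => f w) hA
  have hcont : Continuous fun x : ι → F => A (1, x) := by
    have h1 : (fun x : ι → F => A (1, x)) =
        fun x => A (1, 0) + (A.comp (LinearMap.inr F F (ι → F))) x := by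
      funext x
      simp [← map_add]
    rw [h1]
    exact continuous_const.add (LinearMap.continuous_on_pi _)
  have heq : convexHull F (t : Set (ι → F)) = (⋂ y : t, {x | 0 ≤ A (1, x) y}) ∩
      {x | ∑ y, A (1, x) y = 1} ∩ {x | ∑ y : t, A (1, x) y • (y : ι → F) = x} := by
    ext x
    simp only [Set.mem_inter_iff, Set.mem_iInter, Set.mem_ofPred_eq]
    rw [Finset.mem_convexHull']
    constructor
    · rintro ⟨w, h1, h2, h3⟩
      have hx : A (1, x) = fun y : t => w y := by
        rw [← hAL (fun y : t => w y), hLapp, Finset.sum_coe_sort t w,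
          Finset.sum_coe_sort t (fun y => w y • y), h2, h3]
      simp only [hx]
      exact ⟨⟨fun y => h1 y y.2, by rw [Finset.sum_coe_sort t w, h2]⟩,
        by rw [Finset.sum_coe_sort t (fun y => w y • y), h3]⟩
    · rintro ⟨⟨h1, h2⟩, h3⟩
      refine ⟨fun y => if hy : y ∈ t then A (1, x) ⟨y, hy⟩ else 0, fun y hy => ?_, ?_, ?_⟩
      · simpa [hy] using h1 ⟨y, hy⟩
      · rw [← Finset.sum_coe_sort t]; simpa using h2
      · rw [← Finset.sum_coe_sort t]; simpa using h3
  rw [heq]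
  have hc : ∀ y, Continuous fun x : ι → F => A (1, x) y := fun y =>
    (continuous_apply y).comp hcont
  exact ((isClosed_iInter fun y => isClosed_le continuous_const (hc y)).inter
    (isClosed_eq (continuous_finsetSum _ fun y _ => hc y) continuous_const)).inter
    (isClosed_eq (continuous_finsetSum _ fun y _ => (hc y).smul continuous_const) continuous_id)

theorem isClosed_convexHull_of_finite {s : Set (ι → F)} (hs : s.Finite) :
    IsClosed (convexHull F s) := by
  have heq : convexHull F s = ⋃ t ∈ (hs.toFinset.powerset : Set (Finset (ι → F))),
      ⋃ _ : AffineIndependent F ((↑) : t → ι → F), convexHull F (t : Set (ι → F)) := by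
    rw [convexHull_eq_union]
    ext x
    simp [Set.subset_def]
  rw [heq]
  exact (Finset.finite_toSet _).isClosed_biUnion fun t _ =>
    isClosed_iUnion_of_finite fun h => isClosed_convexHull_of_affineIndependent h

end Closed

theorem exists_common_multiple {Y : Type*} (t : Finset Y) (f : Y → ℚ) (hf : ∀ y ∈ t, 0 ≤ f y) :
    ∃ N : ℕ, 0 < N ∧ ∃ m : Y → ℕ, ∀ y ∈ t, (m y : ℚ) = N * f y := by
  classical
  refine ⟨∏ y ∈ t, (f y).den, Finset.prod_pos fun y _ => (f y).den_pos,
    fun y => (∏ z ∈ t.erase y, (f z).den) * (f y).num.toNat, fun y hy => ?_⟩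
  have h1 : ((f y).num.toNat : ℚ) = (f y).num := by
    exact_mod_cast Int.toNat_of_nonneg (Rat.num_nonneg.2 (hf y hy))
  rw [← Finset.mul_prod_erase t _ hy]
  push_cast
  rw [h1, ← Rat.den_mul_eq_num]
  ring

/-- A rational point in the convex hull of integral points is a rational convex combination. -/
theorem exists_nat_weights {J ι : Type*} [Fintype ι] (a : J → ι → ℤ) (P : J → Prop)
    (u : ι → ℚ) (h : (fun l => (u l : F)) ∈ convexHull F ((fun j l => (a j l : F)) '' {j | P j})) :
    ∃ d : J →₀ ℕ, (∀ j ∈ d.support, P j) ∧ 0 < d.degree ∧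
      ∀ l, u l * d.degree = Finsupp.weight a d l := by
  classical
  rw [convexHull_eq_union] at h
  simp only [Set.mem_iUnion] at h
  obtain ⟨t, hts, hai, ht⟩ := h
  obtain ⟨w, hw0, hw1, hw⟩ := Finset.mem_convexHull'.1 ht
  obtain ⟨π, hπ⟩ := (Algebra.linearMap ℚ F).exists_leftInverse_of_injective
    (LinearMap.ker_eq_bot.2 (algebraMap ℚ F).injective)
  have hπq : ∀ r : ℚ, π (r : F) = r := fun r => by
    simpa using congrArg (fun f : ℚ →ₗ[ℚ] ℚ => f r) hπ
  have hπm : ∀ (r : ℚ) (x : F), π (x * r) = π x * r := fun r x => by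
    rw [mul_comm, ← Rat.smul_def, map_smul, smul_eq_mul, mul_comm]
  have : Nonempty J := by
    obtain ⟨y, hy⟩ : t.Nonempty := by
      rw [Finset.nonempty_iff_ne_empty]; rintro rfl; simp at hw1
    exact ⟨(hts hy).choose⟩
  choose! jj hjj using fun y (hy : y ∈ t) => hts hy
  have hy : ∀ y ∈ t, ∀ l, y l = ((a (jj y) l : ℚ) : F) := fun y hyt l => by
    rw [← congrFun (hjj y hyt).2 l]; simp
  have hsum1 : ∑ y ∈ t, π (w y) = 1 := by
    rw [← map_sum, hw1]; simpa using hπq 1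
  have hsum2 : ∀ l, ∑ y ∈ t, π (w y) * a (jj y) l = u l := by
    intro l
    have := congrFun hw l
    simp only [Finset.sum_apply, Pi.smul_apply, smul_eq_mul] at this
    rw [← hπq (u l), ← this, map_sum]
    refine Finset.sum_congr rfl fun y hyt => ?_
    rw [hy y hyt, hπm]
  have huniq := eq_of_affineIndependent hai (w := w) (w' := fun y => (π (w y) : F))
    (by rw [hw1, ← Rat.cast_sum, hsum1, Rat.cast_one])
    (by
      rw [hw]
      funext l
      simp only [Finset.sum_apply, Pi.smul_apply, smul_eq_mul]
      rw [← hsum2 l, Rat.cast_sum]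
      refine Finset.sum_congr rfl fun y hyt => ?_
      rw [hy y hyt, Rat.cast_mul])
  have hpos : ∀ y ∈ t, 0 ≤ π (w y) := fun y hyt => by
    have := hw0 y hyt
    rw [huniq y hyt] at this
    exact_mod_cast this
  obtain ⟨N, hN, m, hm⟩ := exists_common_multiple t (fun y => π (w y)) hpos
  have hdeg : ((∑ y ∈ t, Finsupp.single (jj y) (m y)).degree : ℚ) = N := by
    rw [map_sum]
    push_cast
    calc ∑ y ∈ t, ((Finsupp.single (jj y) (m y)).degree : ℚ) = ∑ y ∈ t, N * π (w y) :=
          Finset.sum_congr rfl fun y hyt => by rw [Finsupp.degree_single, hm y hyt]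
      _ = N := by rw [← Finset.mul_sum, hsum1, mul_one]
  refine ⟨∑ y ∈ t, Finsupp.single (jj y) (m y), fun j hj => ?_, ?_, fun l => ?_⟩
  · rw [Finsupp.mem_support_iff, Finsupp.finsetSum_apply] at hj
    obtain ⟨y, hyt, hne⟩ := Finset.exists_ne_zero_of_sum_ne_zero hj
    rw [Finsupp.single_apply] at hne
    split_ifs at hne with hjy
    · rw [← hjy]; exact (hjj y hyt).1
    · exact absurd rfl hne
  · have : (0 : ℚ) < N := by exact_mod_cast hN
    rw [← hdeg] at this
    exact_mod_cast this
  · rw [hdeg, map_sum, Finset.sum_apply, ← hsum2 l, Finset.sum_mul]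
    push_cast
    refine Finset.sum_congr rfl fun y hyt => ?_
    rw [Finsupp.weight_single, Pi.smul_apply, nsmul_eq_mul]
    push_cast
    rw [hm y hyt]
    ring

end FiniteConvexHull

end ToricMoment

open scoped LinearAlgebra.Projectivization

namespace ToricMoment


section ToricVariety

variable {k : Type*} [Field k] {q r : ℕ}

theorem degree_eq_of_isHomogeneous {n : ℕ} {f : MvPolynomial (Fin (q + 1)) k}
    (hf : f.IsHomogeneous n) {d : Fin (q + 1) →₀ ℕ} (hd : d ∈ f.support) : d.degree = n := by
  rw [Finsupp.degree_eq_weight_one]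
  exact hf (MvPolynomial.mem_support_iff.1 hd)

theorem eval_smul_of_isHomogeneous {n : ℕ} {f : MvPolynomial (Fin (q + 1)) k}
    (hf : f.IsHomogeneous n) (c : k) (z : Fin (q + 1) → k) :
    MvPolynomial.eval (c • z) f = c ^ n * MvPolynomial.eval z f := by
  rw [MvPolynomial.eval_eq', MvPolynomial.eval_eq', Finset.mul_sum]
  refine Finset.sum_congr rfl fun d hd => ?_
  have hdeg : ∑ j, d j = n := by
    rw [← Finsupp.degree_eq_sum, degree_eq_of_isHomogeneous hf hd]
  simp only [Pi.smul_apply, smul_eq_mul, mul_pow, Finset.prod_mul_distrib, Finset.prod_pow_eq_pow_sum,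
    hdeg]
  ring

theorem eval_rep_mk_eq_zero_iff {n : ℕ} {f : MvPolynomial (Fin (q + 1)) k}
    (hf : f.IsHomogeneous n) (z : Fin (q + 1) → k) (hz : z ≠ 0) :
    MvPolynomial.eval (Projectivization.mk k z hz).rep f = 0 ↔ MvPolynomial.eval z f = 0 := by
  obtain ⟨c, hc⟩ := Projectivization.exists_smul_eq_mk_rep k z hz
  rw [← hc, Units.smul_def, eval_smul_of_isHomogeneous hf, mul_eq_zero,
    or_iff_right (pow_ne_zero _ c.ne_zero)]

theorem forall_mem_orbit_iff (a : Fin (q + 1) → Fin r → ℤ) (x : ℙ k (Fin (q + 1) → k)) {n : ℕ}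
    {f : MvPolynomial (Fin (q + 1)) k} (hf : f.IsHomogeneous n) :
    (∀ y ∈ orbit a x, MvPolynomial.eval y.rep f = 0) ↔
      ∀ t, MvPolynomial.eval (torusAct a t x.rep) f = 0 := by
  have h : ∀ t, Projectivization.map (torusAct a t) (torusAct_injective a t) x =
      Projectivization.mk k (torusAct a t x.rep) (by
        rw [← map_zero (torusAct a t)]; exact (torusAct_injective a t).ne x.rep_nonzero) := by
    intro t
    conv_lhs => rw [← x.mk_rep]
    rw [Projectivization.map_mk]
  simp only [orbit, Set.forall_mem_range, h, eval_rep_mk_eq_zero_iff hf]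

/-- The character of weight `u` as a monoid homomorphism to `k`. -/
def characterHom (k : Type*) [Field k] (u : Fin r → ℤ) : (Fin r → kˣ) →* k where
  toFun t := character u t
  map_one' := by simp [character]
  map_mul' s t := by simp [character, mul_zpow, Finset.prod_mul_distrib]

theorem character_add (u v : Fin r → ℤ) (t : Fin r → kˣ) :
    character (u + v) t = character u t * character v t := by
  simp [character, zpow_add, Finset.prod_mul_distrib]

theorem character_zero (t : Fin r → kˣ) : character 0 t = 1 := by simp [character]

theorem character_nsmul (n : ℕ) (u : Fin r → ℤ) (t : Fin r → kˣ) :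
    character (n • u) t = character u t ^ n := by
  induction n with
  | zero => simp [character_zero]
  | succ n ih => rw [succ_nsmul, character_add, ih, pow_succ]

theorem character_sum {J : Type*} (s : Finset J) (u : J → Fin r → ℤ) (t : Fin r → kˣ) :
    character (∑ j ∈ s, u j) t = ∏ j ∈ s, character (u j) t := by
  classical
  induction s using Finset.induction_on with
  | empty => simp [character_zero]
  | insert j s hj ih => rw [Finset.sum_insert hj, Finset.prod_insert hj, character_add, ih]

theorem characterHom_injective [CharZero k] :
    Function.Injective (characterHom k : (Fin r → ℤ) → (Fin r → kˣ) →* k) := by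
  intro u v h
  funext l
  have h2 : (2 : k) ≠ 0 := two_ne_zero
  have hval : ∀ w : Fin r → ℤ,
      characterHom k w (Pi.mulSingle l (Units.mk0 2 h2)) = (2 : k) ^ w l := by
    intro w
    simp only [characterHom, MonoidHom.coe_mk, OneHom.coe_mk, character]
    rw [Finset.prod_eq_single l]
    · simp
    · intro b _ hb; simp [Pi.mulSingle_eq_of_ne hb]
    · simp
  have h1 : (2 : k) ^ u l = 2 ^ v l := by rw [← hval, ← hval, h]
  have h3 : (((2 : ℚ) ^ u l : ℚ) : k) = ((2 : ℚ) ^ v l : ℚ) := by push_cast; exact h1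
  exact zpow_right_injective₀ (by norm_num : (0 : ℚ) < 2) (by norm_num) (Rat.cast_injective h3)

theorem eval_torusAct (a : Fin (q + 1) → Fin r → ℤ) (t : Fin r → kˣ) (z : Fin (q + 1) → k)
    (f : MvPolynomial (Fin (q + 1)) k) :
    MvPolynomial.eval (torusAct a t z) f = ∑ d ∈ f.support,
      (f.coeff d * ∏ j, z j ^ d j) * characterHom k (-Finsupp.weight a d) t := by
  rw [MvPolynomial.eval_eq']
  refine Finset.sum_congr rfl fun d _ => ?_
  have h : characterHom k (-Finsupp.weight a d) t = ∏ j, (character (-a j) t : k) ^ d j := by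
    rw [Finsupp.weight_eq_sum, ← Finset.sum_neg_distrib]
    simp only [characterHom, MonoidHom.coe_mk, OneHom.coe_mk, character_sum, ← smul_neg,
      character_nsmul]
    push_cast
    rfl
  rw [h, mul_assoc, ← Finset.prod_mul_distrib]
  congr 1
  refine Finset.prod_congr rfl fun j _ => ?_
  rw [← mul_pow, mul_comm]
  rfl

/-- The weight components of a polynomial vanishing on a torus orbit vanish on the orbit. -/
theorem weight_component_eq_zero [CharZero k] (a : Fin (q + 1) → Fin r → ℤ)
    (z : Fin (q + 1) → k) {f : MvPolynomial (Fin (q + 1)) k}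
    (hf : ∀ t, MvPolynomial.eval (torusAct a t z) f = 0) (u : Fin r → ℤ) :
    ∑ d ∈ f.support with Finsupp.weight a d = u, f.coeff d * ∏ j, z j ^ d j = 0 := by
  classical
  have hli : LinearIndependent k fun u : Fin r → ℤ => (characterHom k (-u) : (Fin r → kˣ) → k) :=
    (linearIndependent_monoidHom (Fin r → kˣ) k).comp (fun u => characterHom k (-u))
      (characterHom_injective.comp neg_injective)
  by_cases hu : u ∈ f.support.image (Finsupp.weight a)
  · refine linearIndependent_iff'.1 hli (f.support.image (Finsupp.weight a)) (fun u =>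
      ∑ d ∈ f.support with Finsupp.weight a d = u, f.coeff d * ∏ j, z j ^ d j) ?_ u hu
    funext t
    rw [Finset.sum_apply, Pi.zero_apply, ← hf t, eval_torusAct,
      ← Finset.sum_fiberwise_of_maps_to (fun d hd => Finset.mem_image_of_mem (Finsupp.weight a) hd)]
    refine Finset.sum_congr rfl fun u _ => ?_
    rw [Pi.smul_apply, smul_eq_mul, Finset.sum_mul]
    refine Finset.sum_congr rfl fun d hd => ?_
    rw [(Finset.mem_filter.1 hd).2]
  · rw [Finset.filter_false_of_mem, Finset.sum_empty]
    rintro d hd rfl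
    exact hu (Finset.mem_image_of_mem _ hd)

theorem subset_zariskiClosure (A : Set (ℙ k (Fin (q + 1) → k))) : A ⊆ zariskiClosure A :=
  fun x hx _ _ _ h => h x hx

theorem mem_orbit_self (a : Fin (q + 1) → Fin r → ℤ) (x : ℙ k (Fin (q + 1) → k)) :
    x ∈ orbit a x := by
  refine ⟨1, ?_⟩
  have h : torusAct (k := k) a 1 = LinearMap.id := by
    ext z j; simp [torusAct, character]
  have : ∀ (L : (Fin (q + 1) → k) →ₗ[k] (Fin (q + 1) → k)) (hL : Function.Injective L),
      L = LinearMap.id → Projectivization.map L hL x = x := by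
    rintro _ hL rfl
    exact congrFun Projectivization.map_id x
  exact this _ _ h

theorem rep_eq_zero_of_mem_closure (a : Fin (q + 1) → Fin r → ℤ) (x : ℙ k (Fin (q + 1) → k))
    {p : ℙ k (Fin (q + 1) → k)} (hp : p ∈ zariskiClosure (orbit a x)) {j : Fin (q + 1)}
    (hj : x.rep j = 0) : p.rep j = 0 := by
  have := hp 1 (MvPolynomial.X j) (MvPolynomial.isHomogeneous_X k j)
    ((forall_mem_orbit_iff a x (MvPolynomial.isHomogeneous_X k j)).2 fun t => by
      simp [torusAct, hj])
  simpa using this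

/-- Points satisfying the binomial equations of the orbit of `x` lie in its closure. -/
theorem mk_mem_closure [CharZero k] (a : Fin (q + 1) → Fin r → ℤ) (x : ℙ k (Fin (q + 1) → k))
    (z : Fin (q + 1) → k) (hz : z ≠ 0) (h0 : ∀ j, x.rep j = 0 → z j = 0)
    (h : ∀ d e : Fin (q + 1) →₀ ℕ, d.degree = e.degree → Finsupp.weight a d = Finsupp.weight a e →
      (∏ j, z j ^ d j) * ∏ j, x.rep j ^ e j = (∏ j, z j ^ e j) * ∏ j, x.rep j ^ d j) :
    Projectivization.mk k z hz ∈ zariskiClosure (orbit a x) := by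
  classical
  intro n f hf hvan
  rw [eval_rep_mk_eq_zero_iff hf]
  rw [forall_mem_orbit_iff a x hf] at hvan
  rw [MvPolynomial.eval_eq', ← Finset.sum_fiberwise_of_maps_to
    (fun d hd => Finset.mem_image_of_mem (Finsupp.weight a) hd)]
  refine Finset.sum_eq_zero fun u _ => ?_
  have hu := weight_component_eq_zero a x.rep hvan u
  have hdeg : ∀ d ∈ f.support, d.degree = n := fun d hd => degree_eq_of_isHomogeneous hf hd
  by_cases he : ∃ e ∈ f.support.filter (Finsupp.weight a · = u), ∏ j, x.rep j ^ e j ≠ 0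
  · obtain ⟨e, he, hne⟩ := he
    rw [Finset.mem_filter] at he
    refine (mul_eq_zero.1 ?_).resolve_right hne
    calc (∑ d ∈ f.support with Finsupp.weight a d = u, f.coeff d * ∏ j, z j ^ d j) *
          ∏ j, x.rep j ^ e j
        = (∏ j, z j ^ e j) * ∑ d ∈ f.support with Finsupp.weight a d = u,
            f.coeff d * ∏ j, x.rep j ^ d j := by
          rw [Finset.sum_mul, Finset.mul_sum]
          refine Finset.sum_congr rfl fun d hd => ?_
          rw [Finset.mem_filter] at hd
          have := h d e (by rw [hdeg d hd.1, hdeg e he.1]) (by rw [hd.2, he.2])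
          rw [mul_assoc, this]; ring
      _ = 0 := by rw [hu, mul_zero]
  · push Not at he
    refine Finset.sum_eq_zero fun d hd => ?_
    obtain ⟨j, -, hj⟩ := Finset.prod_eq_zero_iff.1 (he d hd)
    rw [Finset.prod_eq_zero (Finset.mem_univ j), mul_zero]
    rw [h0 j (eq_zero_of_pow_eq_zero hj)]
    exact zero_pow fun h => by simp [h] at hj

theorem exists_mem_rep_ne_zero_iff (a : Fin (q + 1) → Fin r → ℤ) (x : ℙ k (Fin (q + 1) → k))
    (j : Fin (q + 1)) : (∃ p ∈ zariskiClosure (orbit a x), p.rep j ≠ 0) ↔ x.rep j ≠ 0 :=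
  ⟨fun ⟨_, hp, hj⟩ h => hj (rep_eq_zero_of_mem_closure a x hp h),
    fun h => ⟨x, subset_zariskiClosure _ (mem_orbit_self a x), h⟩⟩

theorem eval_eq_zero_of_mem_homogeneousIdeal {W : Set (ℙ k (Fin (q + 1) → k))}
    {f : MvPolynomial (Fin (q + 1)) k} (hf : f ∈ homogeneousIdeal W) {p : ℙ k (Fin (q + 1) → k)}
    (hp : p ∈ W) : MvPolynomial.eval p.rep f = 0 := by
  have hle : homogeneousIdeal W ≤ RingHom.ker (MvPolynomial.eval p.rep) :=
    Ideal.span_le.2 fun g hg => hg.2 p hp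
  exact hle hf

theorem mem_semigroup_iff (a : Fin (q + 1) → Fin r → ℤ) (x : ℙ k (Fin (q + 1) → k)) (n : ℕ)
    (u : Fin r → ℤ) : (n, u) ∈ semigroup a (zariskiClosure (orbit a x)) ↔
      ∃ d : Fin (q + 1) →₀ ℕ, (∀ j ∈ d.support, x.rep j ≠ 0) ∧ d.degree = n ∧
        Finsupp.weight a d = u := by
  classical
  set W := zariskiClosure (orbit a x) with hW
  constructor
  · intro h
    by_contra hno
    push Not at hno
    refine h (le_bot_iff.1 ?_)
    rintro _ ⟨f, ⟨hf1, hf2⟩, rfl⟩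
    rw [SetLike.mem_coe, MvPolynomial.mem_homogeneousSubmodule] at hf1
    rw [SetLike.mem_coe, MvPolynomial.mem_weightedHomogeneousSubmodule] at hf2
    refine (Submodule.mem_bot k).2 (Ideal.Quotient.eq_zero_iff_mem.2 ?_)
    rw [f.as_sum]
    refine Ideal.sum_mem _ fun d hd => ?_
    have hdeg : d.degree = n := degree_eq_of_isHomogeneous hf1 hd
    have hd := MvPolynomial.mem_support_iff.1 hd
    obtain ⟨j, hj, hj0⟩ : ∃ j ∈ d.support, x.rep j = 0 := by
      by_contra hall
      push Not at hall
      exact hno d hall hdeg (hf2 hd)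
    have hX : (MvPolynomial.X j : MvPolynomial (Fin (q + 1)) k) ∈ homogeneousIdeal W :=
      Ideal.subset_span ⟨⟨1, MvPolynomial.isHomogeneous_X k j⟩, fun p hp => by
        simpa using rep_eq_zero_of_mem_closure a x hp hj0⟩
    refine Ideal.mem_of_dvd _ ?_ hX
    rw [MvPolynomial.X_dvd_monomial]
    exact Or.inr (Finsupp.mem_support_iff.1 hj)
  · rintro ⟨d, hd, rfl, rfl⟩ hbot
    have hmem : (Ideal.Quotient.mkₐ k (homogeneousIdeal W)).toLinearMap
        (MvPolynomial.monomial d 1) ∈ weightPiece a W d.degree (Finsupp.weight a d) :=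
      Submodule.mem_map_of_mem ⟨MvPolynomial.isHomogeneous_monomial 1 rfl,
        MvPolynomial.isWeightedHomogeneous_monomial a d 1 rfl⟩
    have hbot : weightPiece a W d.degree (Finsupp.weight a d) = ⊥ := hbot
    rw [hbot, Submodule.mem_bot] at hmem
    have h0 := eval_eq_zero_of_mem_homogeneousIdeal (Ideal.Quotient.eq_zero_iff_mem.1 hmem)
      (subset_zariskiClosure _ (mem_orbit_self a x))
    rw [MvPolynomial.eval_monomial, one_mul, Finsupp.prod, Finset.prod_eq_zero_iff] at h0
    obtain ⟨j, hj, hj0⟩ := h0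
    exact hd j hj (eq_zero_of_pow_eq_zero hj0)

end ToricVariety

end ToricMoment

open scoped LinearAlgebra.Projectivization

namespace ToricMoment


@[to_additive]
theorem prod_subtype_eq_prod {J M : Type*} [Fintype J] [CommMonoid M] (P : J → Prop)
    [Fintype {j // P j}] (f : J → M) (h : ∀ j, ¬ P j → f j = 1) :
    ∏ j : {j // P j}, f j = ∏ j, f j := by
  classical
  rw [← Finset.prod_subtype (Finset.univ.filter P) (by simp) f]
  exact Finset.prod_subset (Finset.filter_subset _ _) fun j _ hj => h j (by simpa using hj)

section MomentImage

variable {F k : Type*} [Field F] [LinearOrder F] [IsStrictOrderedRing F] [IsRealClosed F]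
  [Field k] [Algebra F k] {q r : ℕ}

theorem modulus_algebraMap_sq {i : k} (hi : i ^ 2 = -1)
    (hk : IntermediateField.adjoin F {i} = ⊤) (s : F) :
    modulus F i (algebraMap F k s) ^ 2 = s ^ 2 := by
  have h := reIm_add_mul hi hk s 0
  rw [map_zero, zero_mul, add_zero] at h
  rw [(modulus_spec i _).2, h]
  ring

theorem momentMap_mem {i : k} (hi : i ^ 2 = -1) (hk : IntermediateField.adjoin F {i} = ⊤)
    (a : Fin (q + 1) → Fin r → ℤ) (p : ℙ k (Fin (q + 1) → k)) (P : Fin (q + 1) → Prop)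
    (hP : ∀ j, p.rep j ≠ 0 → P j) :
    momentMap F i a p ∈ convexHull F ((fun j l => (a j l : F)) '' {j | P j}) := by
  have hpos : 0 < ∑ j, modulus F i (p.rep j) ^ 2 := by
    obtain ⟨j, hj⟩ := Function.ne_iff.1 p.rep_nonzero
    exact Finset.sum_pos' (fun j _ => sq_nonneg _) ⟨j, Finset.mem_univ _, modulus_sq_pos hi hk hj⟩
  refine (mem_convexHull_image_iff _ P).2
    ⟨fun j => (∑ j, modulus F i (p.rep j) ^ 2)⁻¹ * modulus F i (p.rep j) ^ 2, fun j => ?_,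
      fun j hj => ?_, ?_, ?_⟩
  · positivity
  · have h0 : p.rep j = algebraMap F k 0 := by
      rw [map_zero]; exact not_not.1 fun h => hj (hP j h)
    beta_reduce
    rw [h0, modulus_algebraMap_sq hi hk]; simp
  · rw [← Finset.mul_sum, inv_mul_cancel₀ hpos.ne']
  · simp only [momentMap, momentVec, mul_smul, Finset.smul_sum]

theorem exists_mem_closure_momentMap_eq [IsAlgClosed k] [CharZero k] {i : k} (hi : i ^ 2 = -1)
    (hk : IntermediateField.adjoin F {i} = ⊤) (a : Fin (q + 1) → Fin r → ℤ)
    (x : ℙ k (Fin (q + 1) → k)) {v : Fin r → F}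
    (hv : v ∈ convexHull F ((fun j l => (a j l : F)) '' {j | x.rep j ≠ 0})) :
    ∃ p ∈ zariskiClosure (orbit a x), momentMap F i a p = v := by
  classical
  obtain ⟨lam, hl0, hlP, hl1, hlv⟩ := (mem_convexHull_image_iff _ _).1 hv
  obtain ⟨ρ, hρ0, hρ1, hρ2⟩ := exists_toric_point (polynomialIVT_of_isAlgClosed hi hk)
    (J := {j // x.rep j ≠ 0}) (ι := Option (Fin r)) (a := fun j o => o.elim 1 (a j)) (l₀ := none)
    (fun _ => rfl) (c := fun j => modulus F i (x.rep j) ^ 2) (lam := fun j => lam j)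
    (fun j => modulus_sq_pos hi hk j.2) (fun j => hl0 j)
  have hs : ∀ j, ∃ s : F, 0 ≤ s ∧ s ^ 2 = ρ j := fun j => by
    obtain ⟨s, hs⟩ := IsRealClosed.exists_eq_pow_of_nonneg (hρ0 j) two_ne_zero
    exact ⟨|s|, abs_nonneg s, by rw [sq_abs, hs]⟩
  choose s hs0 hs1 using hs
  set w : Fin (q + 1) → F := fun j => if h : x.rep j ≠ 0 then s ⟨j, h⟩ else 0 with hw
  have hws : ∀ j : {j // x.rep j ≠ 0}, w j = s j := fun j => by simp [hw, j.2]
  have hw0 : ∀ j, 0 ≤ w j := fun j => by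
    by_cases h : x.rep j ≠ 0
    · exact (hs0 ⟨j, h⟩).trans (hws ⟨j, h⟩).ge
    · simp only [hw, dif_neg h, le_refl]
  set z : Fin (q + 1) → k := fun j => x.rep j * algebraMap F k (w j) with hz
  have hmod : ∀ j, modulus F i (z j) ^ 2 = modulus F i (x.rep j) ^ 2 * w j ^ 2 := fun j => by
    rw [hz, modulus_sq_mul hi hk, modulus_algebraMap_sq hi hk]
  have hsum : ∀ b : Fin (q + 1) → F, ∑ j, modulus F i (z j) ^ 2 * b j =
      ∑ j : {j // x.rep j ≠ 0}, modulus F i (x.rep j) ^ 2 * ρ j * b j := fun b => by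
    rw [← sum_subtype_eq_sum (fun j => x.rep j ≠ 0)]
    · exact Finset.sum_congr rfl fun j _ => by rw [hmod, hws, hs1]
    · intro j hj; simp [hmod, hw, hj]
  have hsl : ∀ b : Fin (q + 1) → F, ∑ j : {j // x.rep j ≠ 0}, lam j * b j =
      ∑ j, lam j * b j := fun b =>
    sum_subtype_eq_sum (fun j => x.rep j ≠ 0) (fun j => lam j * b j)
      fun j hj => by simp [hlP j hj]
  have htot : ∑ j, modulus F i (z j) ^ 2 = 1 := by
    have h1 := hsum fun _ => 1
    have h2 := hρ1 none
    have h3 := hsl fun _ => 1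
    simp only [mul_one, Option.elim_none, Int.cast_one] at h1 h2 h3
    rw [h1, h2, h3, hl1]
  have hz0 : z ≠ 0 := by
    intro h0
    have hm : ∀ j, modulus F i (z j) ^ 2 = 0 := fun j => by
      rw [h0, Pi.zero_apply, ← map_zero (algebraMap F k), modulus_algebraMap_sq hi hk]; simp
    simp [hm] at htot
  refine ⟨Projectivization.mk k z hz0, mk_mem_closure a x z hz0 (fun j hj => by simp [hz, hj]) ?_, ?_⟩
  · intro d e hdeg hwt
    have hprod : ∀ d : Fin (q + 1) →₀ ℕ, ∏ j, z j ^ d j =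
        (∏ j, x.rep j ^ d j) * algebraMap F k (∏ j, w j ^ d j) := fun d => by
      rw [map_prod, ← Finset.prod_mul_distrib]
      exact Finset.prod_congr rfl fun j _ => by rw [hz, map_pow, mul_pow]
    rw [hprod, hprod]
    by_cases hsupp : ∀ j, x.rep j = 0 → d j = 0 ∧ e j = 0
    · have hsq : ∀ d : Fin (q + 1) →₀ ℕ, (∀ j, x.rep j = 0 → d j = 0) →
          (∏ j, w j ^ d j) ^ 2 = ∏ j : {j // x.rep j ≠ 0}, ρ j ^ d j := fun d hd => by
        rw [← prod_subtype_eq_prod (fun j => x.rep j ≠ 0) _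
          (fun j hj => by rw [hd j (not_not.1 hj), pow_zero]), ← Finset.prod_pow]
        refine Finset.prod_congr rfl fun j _ => ?_
        rw [hws, ← hs1, ← pow_mul, ← pow_mul, mul_comm]
      have hint : ∀ (d : Fin (q + 1) →₀ ℕ), (∀ j, x.rep j = 0 → d j = 0) →
          ∀ b : Fin (q + 1) → ℤ, ∑ j : {j // x.rep j ≠ 0}, (d j : ℤ) * b j =
            ∑ j, (d j : ℤ) * b j := fun d hd b =>
        sum_subtype_eq_sum (fun j => x.rep j ≠ 0) (fun j => (d j : ℤ) * b j)
          fun j hj => by simp [hd j (not_not.1 hj)]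
      have hd := fun j hj => (hsupp j hj).1
      have he := fun j hj => (hsupp j hj).2
      have hrel := hρ2 (fun j => d j) (fun j => e j) (by
        rintro (_ | l)
        · have h1 := hint d hd fun _ => 1
          have h2 := hint e he fun _ => 1
          simp only [Option.elim_none]
          rw [h1, h2]
          rw [Finsupp.degree_eq_sum, Finsupp.degree_eq_sum] at hdeg
          simpa using congrArg (Nat.cast : ℕ → ℤ) hdeg
        · have h1 := hint d hd fun j => a j l
          have h2 := hint e he fun j => a j l
          simp only [Option.elim_some]
          rw [h1, h2]
          rw [Finsupp.weight_eq_sum, Finsupp.weight_eq_sum] at hwt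
          simpa using congrFun hwt l)
      have heq : ∏ j, w j ^ d j = ∏ j, w j ^ e j := by
        refine (pow_left_inj₀ (Finset.prod_nonneg fun j _ => pow_nonneg (hw0 j) _)
          (Finset.prod_nonneg fun j _ => pow_nonneg (hw0 j) _) two_ne_zero).1 ?_
        rw [hsq d hd, hsq e he, hrel]
      rw [heq]; ring
    · push Not at hsupp
      obtain ⟨j, hj, hde⟩ := hsupp
      have h0 : (∏ j, x.rep j ^ d j) * ∏ j, x.rep j ^ e j = 0 := by
        by_cases hd : d j = 0
        · rw [Finset.prod_eq_zero (f := fun j => x.rep j ^ e j) (Finset.mem_univ j)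
            (by rw [hj, zero_pow (hde hd)]), mul_zero]
        · rw [Finset.prod_eq_zero (f := fun j => x.rep j ^ d j) (Finset.mem_univ j)
            (by rw [hj, zero_pow hd]), zero_mul]
      linear_combination (algebraMap F k (∏ j, w j ^ d j) - algebraMap F k (∏ j, w j ^ e j)) * h0
  · rw [momentMap_mk hi hk, momentVec, htot, inv_one, one_smul, ← hlv]
    funext l
    simp only [Finset.sum_apply, Pi.smul_apply, smul_eq_mul]
    rw [hsum fun j => (a j l : F), ← hsl fun j => (a j l : F)]
    exact hρ1 (some l)

/-- The moment map image of a toric variety is its weight polytope. -/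
theorem momentMap_image_closure [IsAlgClosed k] [CharZero k] {i : k} (hi : i ^ 2 = -1)
    (hk : IntermediateField.adjoin F {i} = ⊤) (a : Fin (q + 1) → Fin r → ℤ)
    (x : ℙ k (Fin (q + 1) → k)) : momentMap F i a '' zariskiClosure (orbit a x) =
      convexHull F ((fun j l => (a j l : F)) '' {j | x.rep j ≠ 0}) := by
  refine Set.Subset.antisymm ?_ fun v hv => exists_mem_closure_momentMap_eq hi hk a x hv
  rintro _ ⟨p, hp, rfl⟩
  exact momentMap_mem hi hk a p _ fun j hj h => hj (rep_eq_zero_of_mem_closure a x hp h)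

end MomentImage

section Semigroup

variable {F k : Type*} [Field F] [LinearOrder F] [IsStrictOrderedRing F] [Field k] {q r : ℕ}

theorem weightPolytope_closure (a : Fin (q + 1) → Fin r → ℤ) (x : ℙ k (Fin (q + 1) → k)) :
    weightPolytope F a (zariskiClosure (orbit a x)) =
      convexHull F ((fun j l => (a j l : F)) '' {j | x.rep j ≠ 0}) := by
  simp only [weightPolytope, exists_mem_rep_ne_zero_iff]

theorem ratVec_image_rationalBody (a : Fin (q + 1) → Fin r → ℤ) (x : ℙ k (Fin (q + 1) → k)) :
    convexHull F ((fun j l => (a j l : F)) '' {j | x.rep j ≠ 0}) ∩ Set.range (ratVec F) =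
      ratVec F '' rationalBody (semigroup a (zariskiClosure (orbit a x))) := by
  ext v
  constructor
  · rintro ⟨hv, u, rfl⟩
    obtain ⟨d, hd, hpos, hu⟩ := exists_nat_weights a _ u hv
    refine ⟨u, ⟨(d.degree, Finsupp.weight a d), (mem_semigroup_iff a x _ _).2 ⟨d, hd, rfl, rfl⟩,
      hpos, ?_⟩, rfl⟩
    funext l
    rw [← hu l, mul_div_cancel_right₀]
    exact_mod_cast hpos.ne'
  · rintro ⟨_, ⟨⟨n, u⟩, hs, hn, rfl⟩, rfl⟩
    obtain ⟨d, hd, rfl, rfl⟩ := (mem_semigroup_iff a x _ _).1 hs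
    refine ⟨(mem_convexHull_image_iff _ _).2 ⟨fun j => (d j : F) / d.degree, fun j => ?_,
      fun j hj => ?_, ?_, ?_⟩, _, rfl⟩
    · positivity
    · beta_reduce
      rw [Finsupp.notMem_support_iff.1 fun h => hj (hd j h)]; simp
    · have hn' : (d.degree : F) ≠ 0 := by exact_mod_cast hn.ne'
      rw [← Finset.sum_div, div_eq_one_iff_eq hn', Finsupp.degree_eq_sum]
      push_cast
      rfl
    · funext l
      simp only [Finset.sum_apply, Pi.smul_apply, smul_eq_mul, ratVec, Finsupp.weight_eq_sum]
      push_cast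
      rw [Finset.sum_div]
      exact Finset.sum_congr rfl fun j _ => by simp [div_mul_eq_mul_div]

theorem exists_weights_of_mem_hull (a : Fin (q + 1) → Fin r → ℤ) (x : ℙ k (Fin (q + 1) → k))
    {v : F × (Fin r → F)} (hv : v ∈ PointedCone.hull F
      ((fun s : ℕ × (Fin r → ℤ) => ((s.1 : F), fun l => (s.2 l : F))) ''
        semigroup a (zariskiClosure (orbit a x)))) :
    ∃ lam : Fin (q + 1) → F, (∀ j, 0 ≤ lam j) ∧ (∀ j, ¬ x.rep j ≠ 0 → lam j = 0) ∧
      ∑ j, lam j = v.1 ∧ ∑ j, lam j • (fun l => (a j l : F)) = v.2 := by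
  refine Submodule.span_induction (p := fun v _ => ∃ lam : Fin (q + 1) → F, (∀ j, 0 ≤ lam j) ∧
    (∀ j, ¬ x.rep j ≠ 0 → lam j = 0) ∧ ∑ j, lam j = v.1 ∧
      ∑ j, lam j • (fun l => (a j l : F)) = v.2) ?_ ?_ ?_ ?_ hv
  · rintro _ ⟨⟨n, u⟩, hs, rfl⟩
    obtain ⟨d, hd, rfl, rfl⟩ := (mem_semigroup_iff a x _ _).1 hs
    refine ⟨fun j => d j, fun j => Nat.cast_nonneg _, fun j hj => ?_, ?_, ?_⟩
    · beta_reduce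
      rw [Finsupp.notMem_support_iff.1 fun h => hj (hd j h), Nat.cast_zero]
    · rw [Finsupp.degree_eq_sum]; push_cast; rfl
    · funext l
      simp [Finsupp.weight_eq_sum]
  · exact ⟨0, by simp, by simp, by simp, by simp⟩
  · rintro v w - - ⟨l, h1, h2, h3, h4⟩ ⟨m, h1', h2', h3', h4'⟩
    refine ⟨l + m, fun j => add_nonneg (h1 j) (h1' j), fun j hj => ?_, ?_, ?_⟩
    · simp [h2 j hj, h2' j hj]
    · simp [Finset.sum_add_distrib, h3, h3']
    · simp only [Pi.add_apply, add_smul, Finset.sum_add_distrib, h4, h4', Prod.snd_add]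
  · rintro ⟨c, hc⟩ v - ⟨l, h1, h2, h3, h4⟩
    refine ⟨fun j => c * l j, fun j => mul_nonneg hc (h1 j), fun j hj => ?_, ?_, ?_⟩
    · simp [h2 j hj]
    · rw [← Finset.mul_sum, h3]; rfl
    · simp only [mul_smul, ← Finset.smul_sum, h4]; rfl

theorem newtonOkounkovBody_semigroup [TopologicalSpace F] [OrderTopology F]
    (a : Fin (q + 1) → Fin r → ℤ) (x : ℙ k (Fin (q + 1) → k)) :
    newtonOkounkovBody F (semigroup a (zariskiClosure (orbit a x))) =
      convexHull F ((fun j l => (a j l : F)) '' {j | x.rep j ≠ 0}) := by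
  set s : Set (Fin r → F) := (fun j l => (a j l : F)) '' {j | x.rep j ≠ 0} with hs
  refine Set.Subset.antisymm (fun v hv => ?_) (convexHull_min ?_ ?_)
  · by_contra hvs
    have hclosed : IsClosed (convexHull F s) :=
      isClosed_convexHull_of_finite ((Set.toFinite _).image _)
    have hcont : ContinuousAt (fun y : F × (Fin r → F) => y.1⁻¹ • y.2) (1, v) :=
      (continuousAt_fst.inv₀ one_ne_zero).smul continuousAt_snd
    have h1 : ∀ᶠ y in nhds ((1 : F), v), y.1⁻¹ • y.2 ∉ convexHull F s :=
      hcont.eventually (hclosed.isOpen_compl.mem_nhds (by simpa using hvs))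
    have h2 : ∀ᶠ y in nhds ((1 : F), v), 0 < y.1 :=
      continuousAt_fst.eventually (lt_mem_nhds (one_pos : (0 : F) < 1))
    obtain ⟨y, hyC, hy1, hy2⟩ := ((mem_closure_iff_frequently.1 hv).and_eventually
      (h1.and h2)).exists
    obtain ⟨lam, h3, h4, h5, h6⟩ := exists_weights_of_mem_hull a x hyC
    refine hy1 ((mem_convexHull_image_iff _ _).2 ⟨fun j => y.1⁻¹ * lam j,
      fun j => mul_nonneg (inv_pos.2 hy2).le (h3 j), fun j hj => by simp [h4 j hj], ?_, ?_⟩)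
    · rw [← Finset.mul_sum, h5, inv_mul_cancel₀ hy2.ne']
    · simp only [mul_smul, ← Finset.smul_sum, h6]
  · rintro _ ⟨j, hj, rfl⟩
    refine subset_closure (Submodule.subset_span ⟨(1, a j), (mem_semigroup_iff a x _ _).2
      ⟨Finsupp.single j 1, fun j' hj' => ?_, by simp, by simp [Finsupp.weight_single]⟩, by simp⟩)
    obtain rfl : j' = j := by simpa using hj'
    exact hj
  · intro v hv w hw α β hα hβ hαβ
    have hconv : Convex F (closure (PointedCone.hull F
        ((fun s : ℕ × (Fin r → ℤ) => ((s.1 : F), fun l => (s.2 l : F))) ''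
        semigroup a (zariskiClosure (orbit a x))) : Set (F × (Fin r → F)))) :=
      (PointedCone.convex _).closure
    have := hconv hv hw hα hβ hαβ
    simpa [newtonOkounkovBody, hαβ] using this

end Semigroup

end ToricMoment

theorem mainTheorem7 {F k : Type*} [Field F] [LinearOrder F] [IsStrictOrderedRing F]
    [IsRealClosed F] [TopologicalSpace F] [OrderTopology F]
    [Field k] [IsAlgClosed k] [CharZero k] [Algebra F k]
    (i : k) (hi : i ^ 2 = -1) (hk : IntermediateField.adjoin F {i} = ⊤)
    {q r : ℕ} (a : Fin (q + 1) → Fin r → ℤ)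
    (W : Set (Projectivization k (Fin (q + 1) → k))) (hW : ToricMoment.IsToricVariety a W) :
    (ToricMoment.momentMap F i a '' W) ∩ Set.range (ToricMoment.ratVec F) =
        ToricMoment.ratVec F '' ToricMoment.rationalBody (ToricMoment.semigroup a W) ∧
      Convex F (ToricMoment.momentMap F i a '' W) ∧
      ToricMoment.momentMap F i a '' W = ToricMoment.weightPolytope F a W ∧
      ToricMoment.weightPolytope F a W =
        ToricMoment.newtonOkounkovBody F (ToricMoment.semigroup a W) := by
  obtain ⟨x, rfl⟩ := hW
  rw [ToricMoment.momentMap_image_closure hi hk, ToricMoment.weightPolytope_closure,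
    ToricMoment.newtonOkounkovBody_semigroup]
  exact ⟨ToricMoment.ratVec_image_rationalBody a x, convex_convexHull F _, rfl, rfl⟩
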